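/- Let $D\subset\mathbb{R}^d$ be open, bounded and convex with $0\in D$, let $\gamma(x)=\inf\{a\ge 0: x\in aD\}$ be its gauge function and $\zeta_D(u)=\sup_{x\in D}\langle x,u\rangle$ its support function. For $\theta\in S^{d-1}$ let $H(\theta)=\{x:\langle\theta,x\rangle\ge\zeta_D(\theta)\}$. Let $f=g\circ\gamma$ be a probability density on $\mathbb{R}^d$, where $g:[0,\infty)\to(0,\infty)$ is nonincreasing and regularly varying with index $-\alpha$, $\alpha>d$, i.e. $g(tx)/g(t)\to x^{-\alpha}$ as $t\to\infty$ for every $x>0$. Let $k\ge 0$ and let $h_r:(\mathbb{R}^d)^{k+1}\to[0,\infty)$, $r\ge 0$, be measurable symmetric functions that are translation invariant, satisfy $h_r(sx_0,\dots,sx_k)=h_{r/s}(x_0,\dots,x_k)$ for all $s>0$, are bounded by a common constant $M<\infty$, and for which there is a $\kappa$ such that $h_1(x_0,\dots,x_k)>0$ implies $\mathrm{diam}\{x_0,\dots,x_k\}\le\kappa$. Let $t_n\to\infty$, $r_n>0$, $r_n\to r\in[0,\infty)$, let $\mathcal{P}_n$ be a Poisson process on $\mathbb{R}^d$ with intensity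 $nf$, and put $$S_{k,n}(\theta)=\frac1{(k+1)!}\sum h_{r_n}(x_0,\dots,x_k),$$ the sum being over all $(k+1)$-tuples of distinct points of $\mathcal{P}_n\cap t_nH(\theta)$. Then all $S_{k,n}(\theta)$ are square integrable, and the following holds, all integrals being finite. (i) For every $\theta\in S^{d-1}$, $$\lim_{n\to\infty}\frac{\mathbb{E}[S_{k,n}(\theta)]}{[ng(t_n)]^{k+1}r_n^{dk}t_n^d}=\frac{1}{(k+1)!}\int_{(\mathbb{R}^d)^{k+1}}h_1(0,\mathbf{y})\,\mathbf{1}\{x\in H(\theta)\}\,\gamma(x)^{-\alpha(k+1)}\,dx\,d\mathbf{y}.$$ If $A$ is an initial transformation of $D$ at $\theta$, i.e. an invertible linear map with $A(\mathbf{e}_d)=\nabla\zeta_D(\theta)$ (the gradient existing), $A(\{(u,v)\in\mathbb{R}^{d-1}\times\mathbb{R}:v\ge1\})=H(\theta)$ and, for $\gamma_A:=\gamma\circ A$, $\gamma_A(u,1)-\gamma_A(\mathbf{e}_d)\sim\|u\|^2/2$ as $u\to0$, then this limit is also equal to $$\frac{|\det A|}{(k+1)!}\int_{(\mathbb{R}^d)^{k+1}}h_1(0,\mathbf{y})\,\mathbf{1}\{v\ge1\}\,\gamma_A(x)^{-\alpha(k+1)}\,dx\,d\mathbf{y},\qquad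 x=(u,v).$$ (ii) For $1\le\ell\le k+1$ and $\theta_1,\theta_2\in S^{d-1}$ let $$\mathcal{H}_{k,\ell}=\int_{(\mathbb{R}^d)^{2k+2-\ell}}h_1(0,y_1,\dots,y_k)\,h_1(0,y_1,\dots,y_{\ell-1},y_{k+1},\dots,y_{2k+1-\ell})\,\mathbf{1}\{x\in H(\theta_1)\cap H(\theta_2)\}\,\gamma(x)^{-\alpha(2k+2-\ell)}\,dx\,d\mathbf{y},$$ and let $\upsilon_{k,n}$ be $[ng(t_n)]^{k+1}r_n^{dk}t_n^d$, $\;ng(t_n)t_n^d$, $\;[ng(t_n)]^{2k+1}r_n^{2dk}t_n^d$ according as $ng(t_n)r_n^d$ tends to $0$, to $\chi\in(0,\infty)$, or to $\infty$. Then for all $\theta_1,\theta_2\in S^{d-1}$ $$\lim_{n\to\infty}\upsilon_{k,n}^{-1}\mathrm{Cov}(S_{k,n}(\theta_1),S_{k,n}(\theta_2))=\begin{cases}\dfrac{\mathcal{H}_{k,k+1}}{(k+1)!}&\text{if }ng(t_n)r_n^d\to0,\\[2mm]\displaystyle\sum_{\ell=1}^{k+1}\frac{\chi^{2k+1-\ell}\mathcal{H}_{k,\ell}}{\ell!\,((k+1-\ell)!)^2}&\text{if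 }ng(t_n)r_n^d\to\chi\in(0,\infty),\\[2mm]\dfrac{\mathcal{H}_{k,1}}{(k!)^2}&\text{if }ng(t_n)r_n^d\to\infty.\end{cases}$$ -/

import Mathlib

open MeasureTheory ProbabilityTheory Filter Topology
open scoped Pointwise Nat

namespace HalfspaceUStat

noncomputable section

/-- The Euclidean space of dimension `d`. -/
abbrev E (d : ℕ) : Type := EuclideanSpace ℝ (Fin d)

/-! ### Convex geometry -/

/-- The support function of `D`. -/
def supportFun {d : ℕ} (D : Set (E d)) (u : E d) : ℝ :=
  sSup ((fun x : E d => inner ℝ x u) '' D)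

/-- The outer support halfspace of `D` at angle `θ`. -/
def halfspace {d : ℕ} (D : Set (E d)) (θ : E d) : Set (E d) :=
  {x | supportFun D θ ≤ inner ℝ (θ) x}

/-- The last vector of the standard basis, so that `inner ℝ (vert d) (u, v) = v`. -/
def vert (d : ℕ) : E d :=
  WithLp.toLp 2 (fun i : Fin d => if (i : ℕ) + 1 = d then (1 : ℝ) else 0)

/-- `K` is in correct initial position: `γ_K(u, 1) - γ_K(0, 1) ∼ ‖u‖² / 2` as `u → 0`, where the
horizontal coordinate `u` is seen as the vector `(u, 0)`, orthogonal to the vertical direction. -/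
def InCorrectInitialPosition {d : ℕ} (K : Set (E d)) : Prop :=
  Asymptotics.IsEquivalent (𝓝[{w : E d | inner ℝ (vert d) w = 0}] (0 : E d))
    (fun w => gauge K (w + vert d) - gauge K (vert d)) (fun w => ‖w‖ ^ 2 / 2)

/-- `A` is an initial transformation of `D` at angle `θ`. -/
structure IsInitialTransformation {d : ℕ} (D : Set (E d)) (θ : E d) (A : E d ≃ₗ[ℝ] E d) :
    Prop where
  map_vert : HasGradientAt (supportFun D) (A (vert d)) θ
  map_halfspace : A '' {x : E d | 1 ≤ inner ℝ (vert d) x} = halfspace D θ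
  position : InCorrectInitialPosition (A ⁻¹' D)

/-! ### Regular variation -/

/-- `g` varies regularly at infinity with index `ρ`. -/
def RegularlyVarying (g : ℝ → ℝ) (ρ : ℝ) : Prop :=
  ∀ x : ℝ, 0 < x → Tendsto (fun t : ℝ => g (t * x) / g t) atTop (𝓝 (x ^ ρ))

/-! ### Poisson processes -/

/-- The random point set `X` is a Poisson process with intensity measure `μ`: counts are random
variables, have Poisson laws, and are independent over disjoint sets. -/
structure IsPoissonProcess {Ω S : Type*} [MeasurableSpace Ω] [MeasurableSpace S]
    (X : Ω → Set S) (μ : Measure S) (P : Measure Ω) : Prop where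
  measurable_count : ∀ B : Set S, MeasurableSet B → Measurable (fun ω => (X ω ∩ B).encard)
  law : ∀ B : Set S, MeasurableSet B → μ B ≠ ⊤ →
    P.map (fun ω => (X ω ∩ B).encard)
      = (poissonMeasure (μ B).toNNReal).map (Nat.cast : ℕ → ℕ∞)
  law_top : ∀ B : Set S, MeasurableSet B → μ B = ⊤ → ∀ᵐ ω ∂P, (X ω ∩ B).encard = ⊤
  indep : ∀ (m : ℕ) (B : Fin m → Set S), (∀ i, MeasurableSet (B i)) →
    Pairwise (fun i j => Disjoint (B i) (B j)) →
    iIndepFun (fun (i : Fin m) (ω : Ω) => (X ω ∩ B i).encard) P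

/-! ### Local `U`-statistics -/

/-- `h r`, `r ≥ 0`, is an admissible family of kernels of order `k + 1`. -/
structure IsLocalKernel {d : ℕ} (k : ℕ) (h : ℝ → (Fin (k + 1) → E d) → ℝ) : Prop where
  nonneg : ∀ r, 0 ≤ r → ∀ x, 0 ≤ h r x
  measurable : ∀ r, 0 ≤ r → Measurable (h r)
  symm : ∀ r, 0 ≤ r → ∀ (σ : Equiv.Perm (Fin (k + 1))) (x : Fin (k + 1) → E d),
    h r (fun i => x (σ i)) = h r x
  translation : ∀ r, 0 ≤ r → ∀ (y : E d) (x : Fin (k + 1) → E d),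
    h r (fun i => x i + y) = h r x
  locally_determined : ∃ κ : ℝ, ∀ x : Fin (k + 1) → E d,
    0 < h 1 x → Metric.diam (Set.range x) ≤ κ
  scaling : ∀ r, 0 ≤ r → ∀ s : ℝ, 0 < s → ∀ x : Fin (k + 1) → E d,
    h r (fun i => s • x i) = h (r / s) x
  bounded : ∃ M : ℝ, ∀ r, 0 ≤ r → ∀ x, h r x ≤ M

/-- The `U`-statistic with kernel `kern` of the point set `X`: the sum of `kern` over all tuples of
`k + 1` distinct points of `X`, divided by `(k + 1)!`. -/
def uStat {d k : ℕ} (kern : (Fin (k + 1) → E d) → ℝ) (X : Set (E d)) : ℝ :=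
  (1 / ((k + 1)! : ℝ)) *
    ∑' x : {x : Fin (k + 1) → E d // Function.Injective x ∧ ∀ i, x i ∈ X}, kern x

/-! ### The limits -/

/-- The points `y_0 = 0, y_1, …, y_m`, where `y = (y_1, …, y_m)`. -/
def withOrigin {d m : ℕ} (y : Fin m → E d) (j : ℕ) : E d :=
  if hj : 1 ≤ j ∧ j ≤ m then y ⟨j - 1, by omega⟩ else 0

open Classical in
/-- The integrand, in `(x, (y_1, …, y_k))`, of the limit of the expectation, with `G` for the
gauge function and `H` for the halfspace. -/
def meanIntegrand {d k : ℕ} (kern : (Fin (k + 1) → E d) → ℝ) (G : E d → ℝ) (α : ℝ)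
    (H : Set (E d)) (q : E d × (Fin k → E d)) : ℝ :=
  kern (fun i : Fin (k + 1) => withOrigin q.2 i)
    * (if q.1 ∈ H then 1 else 0) * G q.1 ^ (-(α * ((k : ℝ) + 1)))

open Classical in
/-- The integrand of `H_{k,ℓ}` in `(x, (y_1, …, y_{2k+1-ℓ}))`. The first copy of the kernel is
evaluated at `y_0, …, y_k`, the second at `y_0, …, y_{ℓ-1}, y_{k+1}, …, y_{2k+1-ℓ}`. -/
def covIntegrand {d k : ℕ} (kern : (Fin (k + 1) → E d) → ℝ) (G : E d → ℝ) (α : ℝ)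
    (H : Set (E d)) (l : ℕ) (q : E d × (Fin (2 * k + 1 - l) → E d)) : ℝ :=
  kern (fun i : Fin (k + 1) => withOrigin q.2 i)
    * kern (fun i : Fin (k + 1) =>
        withOrigin q.2 (if (i : ℕ) < l then (i : ℕ) else (i : ℕ) + (k + 1 - l)))
    * (if q.1 ∈ H then 1 else 0) * G q.1 ^ (-(α * (2 * (k : ℝ) + 2 - (l : ℝ))))

/-- The integral `H_{k,ℓ}`. -/
def covIntegral {d k : ℕ} (kern : (Fin (k + 1) → E d) → ℝ) (G : E d → ℝ) (α : ℝ)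
    (H : Set (E d)) (l : ℕ) : ℝ :=
  ∫ q : E d × (Fin (2 * k + 1 - l) → E d), covIntegrand kern G α H l q

end

end HalfspaceUStat

open HalfspaceUStat

/-! For a Poisson process with finite intensity measure `μ`, the injective `m`-tuples of points have
intensity `μ^m` (`IsPoissonProcess.bind_tupleMeasure`). Both moments follow from this. The mean is
an integral of the kernel against a product measure. The product of two sums over `N`-tuples splits,
by the number `l` of common points, into sums over injective `(2N - l)`-tuples
(`sum_injTuples_mul_sum_injTuples`); the term `l = 0` has expectation the product of the means, so
the covariance is the sum over `l ≥ 1` (`IsPoissonProcess.covariance_tuple_sum`).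

Every term is then governed by one asymptotic statement, `tendsto_localIntegral`, on `m + 1` points
weighted by a translation invariant kernel of bounded range. The substitution `z₀ = t x`, `zᵢ = t x
+ r yᵢ` extracts the factor `g(t)^(m+1) t^d r^(dm)`. In the new variables all points merge at `x`
because `r / t → 0`, and each ratio `g(t G(·)) / g(t)` tends to `G(x)^(-α)`. Convergence is
dominated: one point carries a Potter bound with exponent `β` in `(d, α)`, the ratios at the other
points are at most `1` since the gauge is at least `1` on the halfspaces and `g` is nonincreasing,
and the bounded range confines `y` to a ball.

With `a = n g(t) r^d`, the term with `l` common points is therefore of order `n g(t) t^d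
a^(2k+1-l)`, and the limit of `a` decides which terms survive. The formula through an initial
transformation is a linear change of variables in `x`. -/

namespace HalfspaceUStat

/-! ### Counting injective tuples -/

open Classical in
/-- The injective tuples with entries in `T`. -/
noncomputable def injTuples {α : Type*} (ι : Type*) [Fintype ι] (T : Finset α) :
    Finset (ι → α) :=
  (Fintype.piFinset fun _ => T).filter Function.Injective

lemma mem_injTuples {α ι : Type*} [Fintype ι] {T : Finset α} {x : ι → α} :
    x ∈ injTuples ι T ↔ Function.Injective x ∧ ∀ i, x i ∈ T := by
  classical
  simp [injTuples, and_comm]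

-- Choosing such a tuple amounts to choosing, separately for each colour, an injection of the
-- positions of that colour into the points of that colour. Falling factorials count these
-- injections.
open Classical in
lemma card_injTuples_colored {α ι κ : Type*} [Fintype ι] [Fintype κ]
    (T : Finset α) (c : α → κ) (col : ι → κ) :
    ((injTuples ι T).filter fun x => ∀ i, c (x i) = col i).card
      = ∏ p : κ, (T.filter fun a => c a = p).card.descFactorial
          (Finset.univ.filter fun i => col i = p).card := by
  have e : {x // x ∈ (injTuples ι T).filter fun x => ∀ i, c (x i) = col i} ≃
      ((p : κ) → ({i // col i = p} ↪ {a // a ∈ T.filter fun a => c a = p})) :=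
    { toFun := fun x p =>
        ⟨fun i => ⟨x.1 i.1, by
          have hx := Finset.mem_filter.1 x.2
          exact Finset.mem_filter.2 ⟨(mem_injTuples.1 hx.1).2 _, (hx.2 _).trans i.2⟩⟩,
        fun i j hij => by
          have hx := Finset.mem_filter.1 x.2
          exact Subtype.ext ((mem_injTuples.1 hx.1).1 (congrArg Subtype.val hij))⟩
      invFun := fun e => ⟨fun i => (e (col i) ⟨i, rfl⟩).1, by
        have key : ∀ i, (e (col i) ⟨i, rfl⟩).1 ∈ T ∧ c (e (col i) ⟨i, rfl⟩).1 = col i := fun i =>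
          Finset.mem_filter.1 (e (col i) ⟨i, rfl⟩).2
        refine Finset.mem_filter.2 ⟨mem_injTuples.2 ⟨?_, fun i => (key i).1⟩, fun i => (key i).2⟩
        intro i j hij
        have hcol : col i = col j := by
          rw [← (key i).2, ← (key j).2]; exact congrArg c hij
        -- The colours are generalised to variables so that their equality can be substituted; `e
        -- (col i)` and `e (col j)` have different types otherwise.
        have aux : ∀ (p q : κ) (hpq : p = q) (hp : col i = p) (hq : col j = q),
            (e p ⟨i, hp⟩).1 = (e q ⟨j, hq⟩).1 → i = j := by
          rintro p q rfl hp hq h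
          exact congrArg Subtype.val ((e p).injective (Subtype.ext h))
        exact aux _ _ hcol rfl rfl hij⟩
      left_inv := fun x => rfl
      right_inv := fun e => by
        funext p
        ext ⟨i, hi⟩
        subst hi
        rfl }
  rw [← Fintype.card_coe, Fintype.card_congr e, Fintype.card_pi]
  refine Finset.prod_congr rfl fun p _ => ?_
  rw [Fintype.card_embedding_eq, Fintype.card_coe, Fintype.card_subtype]

-- The sets `B i` may overlap, so each point is coloured by its pattern `{i | a ∈ B i}`. The
-- patterns cut the space into disjoint atoms, and the count becomes a polynomial in the counts of
-- these atoms, to which independence applies.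
open Classical in
lemma card_injTuples_rectangle {α ι : Type*} [Fintype ι] (T : Finset α) (B : ι → Set α) :
    ((injTuples ι T).filter fun x => ∀ i, x i ∈ B i).card
      = ∑ col ∈ Fintype.piFinset fun i : ι => Finset.univ.filter fun p : Set ι => i ∈ p,
          ∏ p : Set ι, (T.filter fun a => {i | a ∈ B i} = p).card.descFactorial
            (Finset.univ.filter fun i => col i = p).card := by
  rw [Finset.card_eq_sum_card_fiberwise (f := fun x i => {j | x i ∈ B j})
    (t := Fintype.piFinset fun i : ι => Finset.univ.filter fun p : Set ι => i ∈ p)]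
  · refine Finset.sum_congr rfl fun col hcol => ?_
    convert! card_injTuples_colored T (fun a => {i | a ∈ B i}) col using 2
    ext x
    simp only [Finset.mem_filter, and_assoc, funext_iff]
    refine and_congr_right fun _ => ⟨fun h => h.2, fun h => ⟨fun i => ?_, h⟩⟩
    have := (Finset.mem_filter.1 (Fintype.mem_piFinset.1 hcol i)).2
    rw [← h i] at this
    exact this
  · intro x hx
    have := (Finset.mem_filter.1 hx).2
    simpa using this

/-! ### Factorial moments of the Poisson distribution -/

/-- The terms with `n < m` vanish, and shifting the index by `m` leaves `r ^ m` times the total mass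
of the Poisson law. -/
lemma lintegral_descFactorial_poissonMeasure (r : NNReal) (m : ℕ) :
    ∫⁻ n, (n.descFactorial m : ENNReal) ∂(poissonMeasure r) = (r : ENNReal) ^ m := by
  rw [poissonMeasure, lintegral_sum_measure]
  simp_rw [lintegral_smul_measure, lintegral_dirac]
  have hsupp : Function.support (fun n : ℕ => ENNReal.ofReal (Real.exp (-r) * r ^ n / (n)!) •
      (n.descFactorial m : ENNReal)) ⊆ Set.range fun n : ℕ => n + m := by
    intro n hn
    by_contra hnm
    apply hn
    have : n < m := by
      by_contra h
      exact hnm ⟨n - m, by simp; omega⟩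
    simp [Nat.descFactorial_of_lt this]
  rw [← (add_left_injective m).tsum_eq hsupp]
  have hterm : ∀ n : ℕ, ENNReal.ofReal (Real.exp (-r) * r ^ (n + m) / (n + m)!) •
      ((n + m).descFactorial m : ENNReal)
      = (r : ENNReal) ^ m * ENNReal.ofReal (Real.exp (-r) * r ^ n / (n)!) := by
    intro n
    have h1 : ((n + m).descFactorial m : ENNReal)
        = ENNReal.ofReal ((n + m).descFactorial m : ℝ) := by simp
    have h2 : (r : ENNReal) ^ m = ENNReal.ofReal ((r : ℝ) ^ m) := by
      rw [ENNReal.ofReal_pow r.coe_nonneg]; simp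
    have h3 : ((n ! : ℕ) : ℝ) * ((n + m).descFactorial m : ℝ) = ((n + m)! : ℕ) := by
      have := Nat.factorial_mul_descFactorial (Nat.le_add_left m n)
      rw [Nat.add_sub_cancel] at this
      exact_mod_cast this
    rw [h1, h2, smul_eq_mul, ← ENNReal.ofReal_mul (by positivity),
      ← ENNReal.ofReal_mul (by positivity)]
    congr 1
    have h4 : (((n + m)! : ℕ) : ℝ) ≠ 0 := by positivity
    have h5 : ((n ! : ℕ) : ℝ) ≠ 0 := by positivity
    field_simp
    rw [← h3]
    ring
  simp_rw [hterm]
  rw [ENNReal.tsum_mul_left, ← ENNReal.ofReal_tsum_of_nonneg (fun n => by positivity)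
    (hasSum_one_poissonMeasure r).summable, (hasSum_one_poissonMeasure r).tsum_eq]
  simp

/-! ### Factorial moment measures of a Poisson process -/

section Poisson

variable {Ω S : Type*} [MeasurableSpace Ω] [MeasurableSpace S]
  {X : Ω → Set S} {μ : Measure S} {P : Measure Ω}

lemma measurable_descFactorial_count {N : Ω → ℕ∞} (hN : Measurable N) (m : ℕ) :
    Measurable fun ω => ((N ω).toNat.descFactorial m : ENNReal) :=
  (Measurable.of_discrete (f := fun N : ℕ∞ => (N.toNat.descFactorial m : ENNReal))).comp hN

lemma IsPoissonProcess.lintegral_descFactorial (hX : IsPoissonProcess X μ P)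
    [IsFiniteMeasure μ] {B : Set S} (hB : MeasurableSet B) (m : ℕ) :
    ∫⁻ ω, ((X ω ∩ B).encard.toNat.descFactorial m : ENNReal) ∂P = μ B ^ m := by
  have h := hX.law B hB (measure_ne_top _ _)
  rw [← lintegral_map (f := fun N : ℕ∞ => (N.toNat.descFactorial m : ENNReal))
    (by fun_prop) (hX.measurable_count B hB), h, lintegral_map (by fun_prop) (by fun_prop)]
  simp only [ENat.toNat_natCast]
  rw [lintegral_descFactorial_poissonMeasure, ENNReal.coe_toNNReal (measure_ne_top _ _)]

lemma IsPoissonProcess.ae_finite (hX : IsPoissonProcess X μ P) [IsFiniteMeasure μ] :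
    ∀ᵐ ω ∂P, (X ω).Finite := by
  have h := hX.law Set.univ MeasurableSet.univ (measure_ne_top _ _)
  have h2 : ∀ᵐ N ∂(P.map fun ω => (X ω ∩ Set.univ).encard), N ≠ ⊤ := by
    rw [h, ae_map_iff (by fun_prop) (by exact DiscreteMeasurableSpace.forall_measurableSet _)]
    exact Filter.Eventually.of_forall fun n => by simp
  have h3 := ae_of_ae_map (hX.measurable_count _ MeasurableSet.univ).aemeasurable h2
  filter_upwards [h3] with ω hω
  rw [Set.inter_univ] at hω
  exact Set.encard_ne_top_iff.1 hω

lemma IsPoissonProcess.measurableSet_finite (hX : IsPoissonProcess X μ P) :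
    MeasurableSet {ω | (X ω).Finite} := by
  have h := hX.measurable_count _ MeasurableSet.univ
  have : {ω | (X ω).Finite} = (fun ω => (X ω ∩ Set.univ).encard) ⁻¹' {⊤}ᶜ := by
    ext ω
    simp [Set.encard_eq_top_iff]
  rw [this]
  exact h (DiscreteMeasurableSpace.forall_measurableSet _)

lemma IsPoissonProcess.lintegral_prod_descFactorial (hX : IsPoissonProcess X μ P)
    [IsFiniteMeasure μ] {κ : Type*} [Fintype κ] (C : κ → Set S)
    (hC : ∀ p, MeasurableSet (C p)) (hdisj : Pairwise fun p q => Disjoint (C p) (C q))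
    (m : κ → ℕ) :
    ∫⁻ ω, ∏ p, ((X ω ∩ C p).encard.toNat.descFactorial (m p) : ENNReal) ∂P
      = ∏ p, μ (C p) ^ m p := by
  classical
  let e := Fintype.equivFin κ
  have hind := hX.indep (Fintype.card κ) (fun i => C (e.symm i)) (fun i => hC _)
    (fun i j hij => hdisj (fun h => hij (e.symm.injective h)))
  have hind2 := hind.comp (fun i (N : ℕ∞) => (N.toNat.descFactorial (m (e.symm i)) : ENNReal))
    (fun i => by fun_prop)
  have hprod := lintegral_prod_eq_prod_lintegral_of_indepFun Finset.univ _ hind2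
    (fun i => (Measurable.of_discrete).comp (hX.measurable_count _ (hC _)))
  simp only [Function.comp_apply] at hprod
  have h1 : ∀ ω, ∏ p, ((X ω ∩ C p).encard.toNat.descFactorial (m p) : ENNReal)
      = ∏ i, ((X ω ∩ C (e.symm i)).encard.toNat.descFactorial (m (e.symm i)) : ENNReal) :=
    fun ω => (Equiv.prod_comp e.symm
      fun p => ((X ω ∩ C p).encard.toNat.descFactorial (m p) : ENNReal)).symm
  simp_rw [h1]
  refine hprod.trans ?_
  rw [← Equiv.prod_comp e.symm fun p => μ (C p) ^ m p]
  exact Finset.prod_congr rfl fun i _ => hX.lintegral_descFactorial (hC _) _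

open Classical in
/-- The counting measure on the injective tuples with entries in a finite set `X`. -/
noncomputable def tupleMeasure (ι : Type*) [Fintype ι] (X : Set S) : Measure (ι → S) :=
  if h : X.Finite then ∑ x ∈ injTuples ι h.toFinset, Measure.dirac x else 0

instance (ι : Type*) [Fintype ι] (X : Set S) : IsFiniteMeasure (tupleMeasure ι X) := by
  unfold tupleMeasure
  split_ifs <;> infer_instance

lemma lintegral_tupleMeasure {ι : Type*} [Fintype ι] {X : Set S} (hX : X.Finite)
    {u : (ι → S) → ENNReal} (hu : Measurable u) :
    ∫⁻ x, u x ∂(tupleMeasure ι X) = ∑ x ∈ injTuples ι hX.toFinset, u x := by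
  rw [tupleMeasure, dif_pos hX, lintegral_finsetSum_measure]
  exact Finset.sum_congr rfl fun x _ => lintegral_dirac' _ hu

open Classical in
lemma tupleMeasure_pi {ι : Type*} [Fintype ι] {X : Set S} (hX : X.Finite) {B : ι → Set S}
    (hB : ∀ i, MeasurableSet (B i)) :
    tupleMeasure ι X (Set.univ.pi B)
      = ∑ col ∈ Fintype.piFinset fun i : ι => Finset.univ.filter fun p : Set ι => i ∈ p,
          ∏ p : Set ι, ((X ∩ {a | {i | a ∈ B i} = p}).encard.toNat.descFactorial
            (Finset.univ.filter fun i => col i = p).card : ENNReal) := by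
  have hm : MeasurableSet (Set.univ.pi B) := MeasurableSet.univ_pi hB
  rw [← lintegral_indicator_one hm, lintegral_tupleMeasure hX (measurable_one.indicator hm)]
  have h1 : ∑ x ∈ injTuples ι hX.toFinset, (Set.univ.pi B).indicator (1 : (ι → S) → ENNReal) x
      = (((injTuples ι hX.toFinset).filter fun x => ∀ i, x i ∈ B i).card : ENNReal) := by
    simp [Set.indicator_apply, Finset.sum_boole]
  rw [h1, card_injTuples_rectangle]
  push_cast
  refine Finset.sum_congr rfl fun col _ => Finset.prod_congr rfl fun p _ => ?_
  have h2 : X ∩ {a | {i | a ∈ B i} = p}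
      = ((hX.toFinset.filter fun a => {i | a ∈ B i} = p : Finset S) : Set S) := by
    ext a; simp
  rw [h2, Set.encard_coe_eq_coe_finsetCard, ENat.toNat_natCast]

lemma measurableSet_pattern {ι : Type*} [Fintype ι] {B : ι → Set S}
    (hB : ∀ i, MeasurableSet (B i)) (p : Set ι) : MeasurableSet {a | {i | a ∈ B i} = p} := by
  classical
  have : {a | {i | a ∈ B i} = p} = ⋂ i, {a | a ∈ B i ↔ i ∈ p} := by
    ext a; simp [Set.ext_iff]
  rw [this]
  refine MeasurableSet.iInter fun i => ?_
  by_cases hi : i ∈ p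
  · simpa [hi] using hB i
  · simp only [hi, iff_false]
    exact (hB i).compl

/-- Rectangles form a generating π-system, and on them the mass is a polynomial in counts of atoms.
The event that `X ω` is infinite, where the measure is zero by definition, is split off. -/
lemma IsPoissonProcess.measurable_tupleMeasure (hX : IsPoissonProcess X μ P)
    (ι : Type*) [Fintype ι] : Measurable fun ω => tupleMeasure ι (X ω) := by
  classical
  have hrect : ∀ B : ι → Set S, (∀ i, MeasurableSet (B i)) →
      Measurable fun ω => tupleMeasure ι (X ω) (Set.univ.pi B) := by
    intro B hB
    have : (fun ω => tupleMeasure ι (X ω) (Set.univ.pi B))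
        = {ω | (X ω).Finite}.indicator fun ω =>
        ∑ col ∈ Fintype.piFinset fun i : ι => Finset.univ.filter fun p : Set ι => i ∈ p,
          ∏ p : Set ι, ((X ω ∩ {a | {i | a ∈ B i} = p}).encard.toNat.descFactorial
            (Finset.univ.filter fun i => col i = p).card : ENNReal) := by
      funext ω
      by_cases h : (X ω).Finite
      · rw [Set.indicator_of_mem (by exact h), tupleMeasure_pi h hB]
      · rw [Set.indicator_of_notMem (by exact h), tupleMeasure, dif_neg h]; rfl
    rw [this]
    refine Measurable.indicator ?_ hX.measurableSet_finite
    refine Finset.measurable_fun_sum _ fun col _ => Finset.measurable_fun_prod _ fun p _ => ?_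
    exact measurable_descFactorial_count (hX.measurable_count _ (measurableSet_pattern hB p)) _
  refine Measurable.measure_of_isPiSystem generateFrom_pi.symm isPiSystem_pi ?_ ?_
  · rintro _ ⟨B, hB, rfl⟩
    exact hrect B fun i => hB i (Set.mem_univ i)
  · simpa using hrect (fun _ => Set.univ) fun _ => MeasurableSet.univ

/-- The factorial moment measure of a Poisson process is a product measure. On a rectangle,
independence over the atoms turns each colouring into a product of atom masses; summing over
colourings is the expansion of `∏ i, μ (B i)`, where `μ (B i)` is the sum over the patterns that
contain `i`. -/
lemma IsPoissonProcess.bind_tupleMeasure (hX : IsPoissonProcess X μ P) [IsFiniteMeasure μ]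
    (ι : Type*) [Fintype ι] :
    P.bind (fun ω => tupleMeasure ι (X ω)) = Measure.pi fun _ : ι => μ := by
  classical
  refine (Measure.pi_eq fun B hB => ?_).symm
  rw [Measure.bind_apply (MeasurableSet.univ_pi hB) (hX.measurable_tupleMeasure ι).aemeasurable]
  have hcount : ∀ p : Set ι, Measurable fun ω => (X ω ∩ {a | {i | a ∈ B i} = p}).encard :=
    fun p => hX.measurable_count _ (measurableSet_pattern hB p)
  rw [lintegral_congr_ae (g := fun ω =>
      ∑ col ∈ Fintype.piFinset fun i : ι => Finset.univ.filter fun p : Set ι => i ∈ p,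
          ∏ p : Set ι, ((X ω ∩ {a | {i | a ∈ B i} = p}).encard.toNat.descFactorial
            (Finset.univ.filter fun i => col i = p).card : ENNReal))
    (hX.ae_finite.mono fun ω hω => tupleMeasure_pi hω hB)]
  rw [lintegral_finsetSum _ fun col _ => Finset.measurable_fun_prod _ fun p _ =>
    measurable_descFactorial_count (hcount p) _]
  have hterm : ∀ col : ι → Set ι,
      ∫⁻ ω, ∏ p : Set ι, ((X ω ∩ {a | {i | a ∈ B i} = p}).encard.toNat.descFactorial
            (Finset.univ.filter fun i => col i = p).card : ENNReal) ∂P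
        = ∏ i, μ {a | {j | a ∈ B j} = col i} := by
    intro col
    rw [hX.lintegral_prod_descFactorial (fun p => {a | {i | a ∈ B i} = p})
      (fun p => measurableSet_pattern hB p)
      (fun p q hpq => Set.disjoint_left.2 fun a ha hb => hpq (ha.symm.trans hb))]
    rw [← Finset.prod_fiberwise_of_maps_to (s := Finset.univ) (t := Finset.univ) (g := col)
      (fun _ _ => Finset.mem_univ _)]
    refine Finset.prod_congr rfl fun p _ => ?_
    rw [Finset.prod_congr rfl (g := fun _ => μ {a | {j | a ∈ B j} = p})
      (fun i hi => by rw [(Finset.mem_filter.1 hi).2]), Finset.prod_const]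
  simp_rw [hterm]
  refine (Finset.prod_univ_sum _ fun (i : ι) (p : Set ι) => μ {a | {j | a ∈ B j} = p}).symm.trans ?_
  refine Finset.prod_congr rfl fun i _ => ?_
  rw [← measure_biUnion_finset]
  · congr 1
    ext a
    simp
  · intro p _ q _ hpq
    exact Set.disjoint_left.2 fun a ha hb => hpq (ha.symm.trans hb)
  · exact fun p _ => measurableSet_pattern hB p

end Poisson

/-! ### Products of sums over tuples -/

section Overlap

variable {α R : Type*} [Field R]

-- Two injective tuples with the same image differ by a permutation. Passing to functions of finite
-- sets makes the overlap of two tuples an intersection of sets.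
open Classical in
lemma exists_eq_image_of_symm {N : ℕ} {u : (Fin N → α) → R}
    (hu : ∀ (σ : Equiv.Perm (Fin N)) x, u (fun i => x (σ i)) = u x) :
    ∃ U : Finset α → R, ∀ x, Function.Injective x → u x = U (Finset.univ.image x) := by
  refine ⟨fun A => if h : ∃ x : Fin N → α, Function.Injective x ∧ Finset.univ.image x = A
    then u h.choose else 0, fun x hx => ?_⟩
  have h : ∃ y : Fin N → α, Function.Injective y ∧ Finset.univ.image y = Finset.univ.image x :=
    ⟨x, hx, rfl⟩
  show u x = dite _ _ _
  rw [dif_pos h]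
  obtain ⟨hy, hxy⟩ := h.choose_spec
  set y := h.choose
  have hmem : ∀ i, ∃ j, y j = x i := fun i => by
    have : x i ∈ Finset.univ.image y := hxy ▸ Finset.mem_image_of_mem x (Finset.mem_univ i)
    simpa using this
  choose σ hσ using hmem
  have hinj : Function.Injective σ := fun i j hij => hx (by rw [← hσ i, ← hσ j, hij])
  rw [← hu (Equiv.ofBijective σ (Finite.injective_iff_bijective.1 hinj)) y]
  congr 1
  funext i
  exact (hσ i).symm

/-- This turns a condition on an image into a colouring condition on the entries; one inclusion is
enough because the cardinalities agree. -/
lemma image_eq_iff_of_injective [DecidableEq α] {ι κ : Type*} [Fintype ι] [Fintype κ]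
    {z : κ → α} (hz : Function.Injective z) {a : ι → κ} (ha : Function.Injective a)
    {A : Finset α} (hA : A.card = Fintype.card ι) :
    Finset.univ.image (fun i => z (a i)) = A ↔ ∀ j, z j ∈ A ↔ j ∈ Set.range a := by
  constructor
  · rintro rfl j
    simp only [Finset.mem_image, Finset.mem_univ, true_and, Set.mem_range]
    exact ⟨fun ⟨i, hi⟩ => ⟨i, hz hi⟩, fun ⟨i, hi⟩ => ⟨i, by rw [hi]⟩⟩
  · intro h
    refine Finset.eq_of_subset_of_card_le (fun y hy => ?_) ?_
    · obtain ⟨i, -, rfl⟩ := Finset.mem_image.1 hy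
      exact (h _).2 ⟨i, rfl⟩
    · rw [hA, Finset.card_image_of_injective _ (f := fun i => z (a i)) (hz.comp ha), Finset.card_univ]

open Classical in
lemma card_injTuples_image_eq {N : ℕ} {T A : Finset α} (hA : A ∈ T.powersetCard N) :
    ((injTuples (Fin N) T).filter fun x => Finset.univ.image x = A).card = N ! := by
  obtain ⟨hAT, hcard⟩ := Finset.mem_powersetCard.1 hA
  have h := card_injTuples_colored T (fun a => decide (a ∈ A)) (fun _ : Fin N => true)
  have h1 : (T.filter fun a => a ∈ A) = A := by
    ext a; simp only [Finset.mem_filter]; exact ⟨fun h => h.2, fun h => ⟨hAT h, h⟩⟩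
  simp only [Fintype.univ_bool, Finset.mem_singleton, Bool.true_eq_false, not_false_eq_true,
    Finset.prod_insert, decide_eq_true_eq, h1, hcard, Finset.filter_true, Finset.card_univ,
    Fintype.card_fin, Nat.descFactorial_self, Finset.prod_singleton, Finset.filter_false,
    Finset.card_empty, Nat.descFactorial_zero, mul_one] at h
  rw [← h]
  congr 1
  refine Finset.filter_congr fun x hx => ?_
  have := image_eq_iff_of_injective (mem_injTuples.1 hx).1 (a := (id : Fin N → Fin N))
    Function.injective_id (A := A) (by simpa using hcard)
  simpa using this

open Classical in
lemma sum_injTuples_eq_sum_powersetCard {M : Type*} [AddCommMonoid M] {N : ℕ} (T : Finset α)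
    (F : Finset α → M) :
    ∑ x ∈ injTuples (Fin N) T, F (Finset.univ.image x) = ∑ A ∈ T.powersetCard N, N ! • F A := by
  rw [← Finset.sum_fiberwise_of_maps_to (t := T.powersetCard N)
    (g := fun x : Fin N → α => Finset.univ.image x)]
  · refine Finset.sum_congr rfl fun A hA => ?_
    rw [Finset.sum_congr rfl (g := fun _ => F A)
      (fun x hx => by rw [(Finset.mem_filter.1 hx).2]), Finset.sum_const,
      card_injTuples_image_eq hA]
  · intro x hx
    obtain ⟨hinj, hT⟩ := mem_injTuples.1 hx
    refine Finset.mem_powersetCard.2 ⟨fun y hy => ?_, ?_⟩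
    · obtain ⟨i, -, rfl⟩ := Finset.mem_image.1 hy
      exact hT i
    · rw [Finset.card_image_of_injective _ hinj, Finset.card_univ, Fintype.card_fin]

/-- The positions, among `M = 2 N - l` points, of the first `N`-tuple. -/
def fstIdx {N M l : ℕ} (hl : l ≤ N) (hM : M + l = 2 * N) (i : Fin N) : Fin M :=
  ⟨i, by omega⟩

/-- The positions, among `M = 2 N - l` points, of the second `N`-tuple, which shares its first `l`
points with the first one. -/
def sndIdx {N M l : ℕ} (hl : l ≤ N) (hM : M + l = 2 * N) (i : Fin N) : Fin M :=
  ⟨if (i : ℕ) < l then i else i + (N - l), by split_ifs <;> omega⟩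

section

variable {N M l : ℕ} (hl : l ≤ N) (hM : M + l = 2 * N)

lemma fstIdx_injective : Function.Injective (fstIdx hl hM) := fun i j h => by
  simpa [fstIdx, Fin.ext_iff] using h

lemma sndIdx_injective : Function.Injective (sndIdx hl hM) := fun i j h => by
  simp only [sndIdx, Fin.mk.injEq] at h
  apply Fin.ext
  split_ifs at h <;> omega

lemma mem_range_fstIdx (j : Fin M) : j ∈ Set.range (fstIdx hl hM) ↔ (j : ℕ) < N := by
  constructor
  · rintro ⟨i, rfl⟩; exact i.2
  · intro h; exact ⟨⟨j, h⟩, rfl⟩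

lemma mem_range_sndIdx (j : Fin M) :
    j ∈ Set.range (sndIdx hl hM) ↔ (j : ℕ) < l ∨ N ≤ (j : ℕ) := by
  constructor
  · rintro ⟨i, rfl⟩
    simp only [sndIdx]
    split_ifs <;> omega
  · rintro (h | h)
    · exact ⟨⟨j, by omega⟩, Fin.ext (by simp [sndIdx, h])⟩
    · refine ⟨⟨j - (N - l), by omega⟩, Fin.ext ?_⟩
      simp only [sndIdx]
      split_ifs <;> omega

lemma card_filter_fin_lt (M a : ℕ) (h : a ≤ M) :
    (Finset.univ.filter fun j : Fin M => (j : ℕ) < a).card = a := by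
  rw [← Fintype.card_subtype, ← Fintype.card_fin a]
  refine Fintype.card_congr ⟨fun j => ⟨j.1, by simpa using j.2⟩, fun j => ⟨⟨j, by omega⟩, by simp⟩,
    fun j => rfl, fun j => rfl⟩

lemma card_filter_fin_Ico (M a b : ℕ) (hab : a ≤ b) (h : b ≤ M) :
    (Finset.univ.filter fun j : Fin M => a ≤ (j : ℕ) ∧ (j : ℕ) < b).card = b - a := by
  have key := Finset.card_sdiff_of_subset
    (s := Finset.univ.filter fun j : Fin M => (j : ℕ) < a)
    (t := Finset.univ.filter fun j : Fin M => (j : ℕ) < b) ?_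
  · rw [card_filter_fin_lt M b h, card_filter_fin_lt M a (hab.trans h)] at key
    rw [← key]
    congr 1
    ext j
    simp only [Finset.mem_filter, Finset.mem_univ, true_and, Finset.mem_sdiff]
    omega
  · intro j
    simp only [Finset.mem_filter, Finset.mem_univ, true_and]
    omega

-- Colour points by membership in `A` and in `B`, and positions by membership in the two index
-- ranges. The classes in `A ∩ B`, `A \ B` and `B \ A` have as many positions as points, namely `l`,
-- `N - l` and `N - l`, and no position falls outside both ranges.
open Classical in
lemma card_injTuples_images_eq {T A B : Finset α} (hA : A ∈ T.powersetCard N)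
    (hB : B ∈ T.powersetCard N) (hAB : (A ∩ B).card = l) :
    ((injTuples (Fin M) T).filter fun z => Finset.univ.image (fun i => z (fstIdx hl hM i)) = A ∧
      Finset.univ.image (fun i => z (sndIdx hl hM i)) = B).card = l ! * ((N - l)!) ^ 2 := by
  obtain ⟨hAT, hAc⟩ := Finset.mem_powersetCard.1 hA
  obtain ⟨hBT, hBc⟩ := Finset.mem_powersetCard.1 hB
  have h := card_injTuples_colored T (fun a => (decide (a ∈ A), decide (a ∈ B)))
    (fun j : Fin M => (decide ((j : ℕ) < N), decide ((j : ℕ) < l ∨ N ≤ (j : ℕ))))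
  have e1 : (injTuples (Fin M) T).filter (fun z =>
      Finset.univ.image (fun i => z (fstIdx hl hM i)) = A ∧
      Finset.univ.image (fun i => z (sndIdx hl hM i)) = B)
      = (injTuples (Fin M) T).filter fun z => ∀ j : Fin M, (decide (z j ∈ A), decide (z j ∈ B))
        = (decide ((j : ℕ) < N), decide ((j : ℕ) < l ∨ N ≤ (j : ℕ))) := by
    refine Finset.filter_congr fun z hz => ?_
    rw [image_eq_iff_of_injective (mem_injTuples.1 hz).1 (fstIdx_injective hl hM) (by simpa using hAc),
      image_eq_iff_of_injective (mem_injTuples.1 hz).1 (sndIdx_injective hl hM) (by simpa using hBc)]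
    simp only [mem_range_fstIdx, mem_range_sndIdx, Prod.mk.injEq, decide_eq_decide, forall_and]
  rw [e1]
  refine Eq.trans (by congr!) (h.trans ?_)
  rw [Fintype.prod_prod_type]
  simp only [Fintype.prod_bool, Prod.mk.injEq, decide_eq_true_eq, decide_eq_false_iff_not]
  have t1 : (T.filter fun a => a ∈ A ∧ a ∈ B) = A ∩ B := by
    ext a; simp only [Finset.mem_filter, Finset.mem_inter]; exact ⟨fun h => h.2, fun h => ⟨hAT h.1, h⟩⟩
  have t2 : (T.filter fun a => a ∈ A ∧ a ∉ B) = A \ B := by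
    ext a; simp only [Finset.mem_filter, Finset.mem_sdiff]; exact ⟨fun h => h.2, fun h => ⟨hAT h.1, h⟩⟩
  have t3 : (T.filter fun a => a ∉ A ∧ a ∈ B) = B \ A := by
    ext a; simp only [Finset.mem_filter, Finset.mem_sdiff]
    exact ⟨fun h => ⟨h.2.2, h.2.1⟩, fun h => ⟨hBT h.1, h.2, h.1⟩⟩
  have c2 : (A \ B).card = N - l := by
    have := Finset.card_inter_add_card_sdiff A B
    omega
  have c3 : (B \ A).card = N - l := by
    have := Finset.card_inter_add_card_sdiff B A
    rw [Finset.inter_comm] at this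
    omega
  have i1 : (Finset.univ.filter fun j : Fin M => (j : ℕ) < N ∧ ((j : ℕ) < l ∨ N ≤ (j : ℕ))).card
      = l := by
    refine Eq.trans ?_ (card_filter_fin_lt M l (by omega))
    congr 1; ext j; simp only [Finset.mem_filter, Finset.mem_univ, true_and]; omega
  have i2 : (Finset.univ.filter fun j : Fin M => (j : ℕ) < N ∧ ¬((j : ℕ) < l ∨ N ≤ (j : ℕ))).card
      = N - l := by
    refine Eq.trans ?_ (card_filter_fin_Ico M l N hl (by omega))
    congr 1; ext j; simp only [Finset.mem_filter, Finset.mem_univ, true_and]; omega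
  have i3 : (Finset.univ.filter fun j : Fin M => ¬(j : ℕ) < N ∧ ((j : ℕ) < l ∨ N ≤ (j : ℕ))).card
      = N - l := by
    rw [show N - l = M - N by omega]
    refine Eq.trans ?_ (card_filter_fin_Ico M N M (by omega) le_rfl)
    congr 1; ext j; simp only [Finset.mem_filter, Finset.mem_univ, true_and]; omega
  have i4 : (Finset.univ.filter fun j : Fin M => ¬(j : ℕ) < N ∧ ¬((j : ℕ) < l ∨ N ≤ (j : ℕ))).card
      = 0 := by
    rw [Finset.card_eq_zero, Finset.filter_eq_empty_iff]
    intro j _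
    omega
  rw [t1, t2, t3, hAB, c2, c3, i1, i2, i3, i4, Nat.descFactorial_self, Nat.descFactorial_self,
    Nat.descFactorial_zero]
  ring

-- The pair of images of an injective tuple is a pair of `N`-sets that meet in exactly `l` points,
-- and each such pair arises from the same number of tuples.
open Classical in
lemma sum_injTuples_overlap (T : Finset α) (U V : Finset α → R) :
    ∑ z ∈ injTuples (Fin M) T, U (Finset.univ.image fun i => z (fstIdx hl hM i)) *
        V (Finset.univ.image fun i => z (sndIdx hl hM i))
      = (l ! * ((N - l)! : R) ^ 2) *
        ∑ p ∈ (T.powersetCard N ×ˢ T.powersetCard N).filter (fun p => (p.1 ∩ p.2).card = l),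
          U p.1 * V p.2 := by
  rw [← Finset.sum_fiberwise_of_maps_to
    (t := (T.powersetCard N ×ˢ T.powersetCard N).filter (fun p => (p.1 ∩ p.2).card = l))
    (g := fun z : Fin M → α => (Finset.univ.image fun i => z (fstIdx hl hM i),
      Finset.univ.image fun i => z (sndIdx hl hM i)))]
  · rw [Finset.mul_sum]
    refine Finset.sum_congr rfl fun p hp => ?_
    obtain ⟨hp1, hp2⟩ := Finset.mem_filter.1 hp
    obtain ⟨hA, hB⟩ := Finset.mem_product.1 hp1
    rw [Finset.sum_congr rfl (g := fun _ => U p.1 * V p.2)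
      (fun x hx => by rw [← (Finset.mem_filter.1 hx).2]), Finset.sum_const]
    simp only [Prod.ext_iff]
    rw [card_injTuples_images_eq hl hM hA hB hp2, nsmul_eq_mul]
    push_cast
    ring
  · intro z hz
    obtain ⟨hinj, hT⟩ := mem_injTuples.1 hz
    have hsub : ∀ a : Fin N → Fin M, Function.Injective a →
        Finset.univ.image (fun i => z (a i)) ∈ T.powersetCard N := fun a ha => by
      refine Finset.mem_powersetCard.2 ⟨fun y hy => ?_, ?_⟩
      · obtain ⟨i, -, rfl⟩ := Finset.mem_image.1 hy
        exact hT _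
      · rw [Finset.card_image_of_injective _ (f := fun i => z (a i)) (hinj.comp ha), Finset.card_univ, Fintype.card_fin]
    refine Finset.mem_filter.2 ⟨Finset.mem_product.2
      ⟨hsub _ (fstIdx_injective hl hM), hsub _ (sndIdx_injective hl hM)⟩, ?_⟩
    have : (Finset.univ.image fun i => z (fstIdx hl hM i)) ∩
        (Finset.univ.image fun i => z (sndIdx hl hM i))
        = ((Finset.univ : Finset (Fin M)).filter fun j : Fin M => (j : ℕ) < l).image z := by
      ext y
      simp only [Finset.mem_inter, Finset.mem_image, Finset.mem_univ, true_and, Finset.mem_filter]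
      constructor
      · rintro ⟨⟨i, rfl⟩, ⟨j, hj⟩⟩
        refine ⟨_, ?_, rfl⟩
        have h1 := (mem_range_sndIdx hl hM (fstIdx hl hM i)).1 ⟨j, hinj hj⟩
        have h2 := (mem_range_fstIdx hl hM (fstIdx hl hM i)).1 ⟨i, rfl⟩
        omega
      · rintro ⟨j, hj, rfl⟩
        obtain ⟨a, ha⟩ := (mem_range_fstIdx hl hM j).2 (by omega)
        obtain ⟨b, hb⟩ := (mem_range_sndIdx hl hM j).2 (by omega)
        exact ⟨⟨a, by rw [ha]⟩, ⟨b, by rw [hb]⟩⟩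
    show Finset.card _ = _
    rw [this, Finset.card_image_of_injective _ hinj, card_filter_fin_lt M l (by omega)]

end

/-- The product of two sums over injective tuples, sorted by the number of common points. -/
lemma sum_injTuples_mul_sum_injTuples [CharZero R] {N : ℕ} {u v : (Fin N → α) → R}
    (hu : ∀ (σ : Equiv.Perm (Fin N)) x, u (fun i => x (σ i)) = u x)
    (hv : ∀ (σ : Equiv.Perm (Fin N)) x, v (fun i => x (σ i)) = v x) (T : Finset α) :
    (∑ x ∈ injTuples (Fin N) T, u x) * (∑ x ∈ injTuples (Fin N) T, v x)
      = ∑ l : Fin (N + 1), ((N ! : R) ^ 2 / ((l : ℕ)! * ((N - l)! : R) ^ 2)) *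
          ∑ z ∈ injTuples (Fin (2 * N - l)) T,
            u (fun i => z (fstIdx (l := l) (by omega) (by omega) i)) *
            v (fun i => z (sndIdx (l := l) (by omega) (by omega) i)) := by
  classical
  obtain ⟨U, hU⟩ := exists_eq_image_of_symm hu
  obtain ⟨V, hV⟩ := exists_eq_image_of_symm hv
  rw [Finset.sum_congr rfl (fun x hx => hU x (mem_injTuples.1 hx).1),
    Finset.sum_congr rfl (fun x hx => hV x (mem_injTuples.1 hx).1),
    sum_injTuples_eq_sum_powersetCard, sum_injTuples_eq_sum_powersetCard,
    Finset.sum_mul_sum, ← Finset.sum_product',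
    ← Finset.sum_fiberwise_of_maps_to (t := (Finset.univ : Finset (Fin (N + 1))))
      -- `Fin.ofNat` reduces modulo `N + 1`, which is harmless since the intersection has at most
      -- `N` elements.
      (g := fun p : Finset α × Finset α => Fin.ofNat (N + 1) (p.1 ∩ p.2).card)
      (fun _ _ => Finset.mem_univ _)]
  refine Finset.sum_congr rfl fun l _ => ?_
  have hz : ∑ z ∈ injTuples (Fin (2 * N - l)) T,
      u (fun i => z (fstIdx (l := l) (by omega) (by omega) i)) *
      v (fun i => z (sndIdx (l := l) (by omega) (by omega) i))
      = ∑ z ∈ injTuples (Fin (2 * N - l)) T,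
        U (Finset.univ.image fun i => z (fstIdx (N := N) (l := l) (by omega) (by omega) i)) *
        V (Finset.univ.image fun i => z (sndIdx (N := N) (l := l) (by omega) (by omega) i)) := by
    refine Finset.sum_congr rfl fun z hz => ?_
    have hinj := (mem_injTuples.1 hz).1
    rw [hU (fun i => z (fstIdx _ _ i)) (hinj.comp (fstIdx_injective _ _)),
      hV (fun i => z (sndIdx _ _ i)) (hinj.comp (sndIdx_injective _ _))]
  rw [hz, sum_injTuples_overlap, ← mul_assoc]
  have h1 : ((l : ℕ)! : R) ≠ 0 := Nat.cast_ne_zero.2 (Nat.factorial_ne_zero _)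
  have h2 : ((N - l)! : R) ≠ 0 := Nat.cast_ne_zero.2 (Nat.factorial_ne_zero _)
  rw [div_mul_cancel₀ _ (mul_ne_zero h1 (pow_ne_zero 2 h2)), Finset.mul_sum]
  refine Finset.sum_congr ?_ fun p _ => ?_
  · refine Finset.filter_congr fun p hp => ?_
    have hc : (p.1 ∩ p.2).card ≤ N := by
      rw [← (Finset.mem_powersetCard.1 (Finset.mem_product.1 hp).1).2]
      exact Finset.card_le_card Finset.inter_subset_left
    rw [Fin.ext_iff, Fin.val_ofNat, Nat.mod_eq_of_lt (by omega)]
  · simp only [nsmul_eq_mul]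
    ring

end Overlap

/-! ### First and second moments of sums over tuples -/

lemma abs_mul_comp_le {S : Type*} {N : ℕ} {u v : (Fin N → S) → ℝ} {C C' : ℝ} (hC : ∀ x, |u x| ≤ C) (hC' : ∀ x, |v x| ≤ C') {M : ℕ}
    (a b : Fin N → Fin M) (z : Fin M → S) :
    |u (fun i => z (a i)) * v (fun i => z (b i))| ≤ C * C' := by
  rw [abs_mul]
  exact mul_le_mul (hC _) (hC' _) (abs_nonneg _) ((abs_nonneg _).trans (hC fun i => z (a i)))

section Moments

variable {Ω S : Type*} [MeasurableSpace Ω] [MeasurableSpace S]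
  {X : Ω → Set S} {μ : Measure S} {P : Measure Ω}

lemma integral_tupleMeasure {ι : Type*} [Fintype ι] {Y : Set S} (hY : Y.Finite)
    {u : (ι → S) → ℝ} (hu : Measurable u) :
    ∫ x, u x ∂(tupleMeasure ι Y) = ∑ x ∈ injTuples ι hY.toFinset, u x := by
  rw [tupleMeasure, dif_pos hY, integral_finsetSum_measure]
  · exact Finset.sum_congr rfl fun x _ => integral_dirac' _ _ hu.stronglyMeasurable
  · intro x _
    refine ⟨hu.aestronglyMeasurable, ?_⟩
    rw [hasFiniteIntegral_iff_enorm, lintegral_dirac' _ hu.enorm]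
    exact enorm_lt_top

/-- The kernel of the random measures counting injective tuples. -/
noncomputable def IsPoissonProcess.tupleKernel (hX : IsPoissonProcess X μ P) (ι : Type*)
    [Fintype ι] : Kernel Ω (ι → S) :=
  ⟨fun ω => tupleMeasure ι (X ω), hX.measurable_tupleMeasure ι⟩

lemma IsPoissonProcess.comp_tupleKernel (hX : IsPoissonProcess X μ P) [IsFiniteMeasure μ]
    (ι : Type*) [Fintype ι] :
    (hX.tupleKernel ι ∘ₖ Kernel.const Unit P) () = Measure.pi fun _ : ι => μ := by
  rw [Kernel.comp_apply, Kernel.const_apply, ← hX.bind_tupleMeasure ι]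
  rfl

lemma IsPoissonProcess.integrable_tuple_sum (hX : IsPoissonProcess X μ P) [IsFiniteMeasure μ]
    {ι : Type*} [Fintype ι] {u : (ι → S) → ℝ} (hu : Integrable u (Measure.pi fun _ : ι => μ)) :
    Integrable (fun ω => ∫ x, u x ∂(tupleMeasure ι (X ω))) P := by
  rw [← hX.comp_tupleKernel ι] at hu
  simpa [tupleKernel] using hu.integral_comp

/-- The multivariate Mecke formula for functions of tuples. -/
lemma IsPoissonProcess.integral_tuple_sum (hX : IsPoissonProcess X μ P) [IsFiniteMeasure μ]
    {ι : Type*} [Fintype ι] {u : (ι → S) → ℝ} (hu : Integrable u (Measure.pi fun _ : ι => μ)) :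
    ∫ ω, ∫ x, u x ∂(tupleMeasure ι (X ω)) ∂P = ∫ x, u x ∂(Measure.pi fun _ : ι => μ) := by
  rw [← hX.comp_tupleKernel ι] at hu ⊢
  rw [Kernel.integral_comp hu]
  simp [tupleKernel]

/-- Bijectivity of `Sum.elim a b` says that `a` and `b` split the coordinates into two complementary
blocks, so the product measure factors. -/
lemma measurePreserving_comp_pair {ι κ : Type*} [Fintype ι] [Fintype κ] [SigmaFinite μ]
    {a b : ι → κ} (hab : Function.Bijective (Sum.elim a b)) :
    MeasurePreserving (fun z : κ → S => ((fun i => z (a i)), fun i => z (b i)))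
      (Measure.pi fun _ => μ) ((Measure.pi fun _ => μ).prod (Measure.pi fun _ => μ)) := by
  let e : ι ⊕ ι ≃ κ := Equiv.ofBijective _ hab
  have h1 := measurePreserving_sumPiEquivProdPi (X := fun _ : ι ⊕ ι => S) (fun _ => μ)
  have h2 := (measurePreserving_piCongrLeft (α := fun _ : κ => S) (fun _ => μ) e).symm
  exact h1.comp h2

lemma integral_mul_comp_pair {ι κ : Type*} [Fintype ι] [Fintype κ] [SigmaFinite μ]
    {a b : ι → κ} (hab : Function.Bijective (Sum.elim a b)) {u v : (ι → S) → ℝ}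
    (hu : Measurable u) (hv : Measurable v) :
    ∫ z, u (fun i => z (a i)) * v (fun i => z (b i)) ∂(Measure.pi fun _ : κ => μ)
      = (∫ x, u x ∂(Measure.pi fun _ : ι => μ)) * ∫ x, v x ∂(Measure.pi fun _ : ι => μ) := by
  rw [← integral_prod_mul, ← (measurePreserving_comp_pair (μ := μ) hab).map_eq,
    integral_map (by fun_prop) (by fun_prop)]

lemma integrable_pi_of_bounded [IsFiniteMeasure μ] {ι : Type*} [Fintype ι] {u : (ι → S) → ℝ}
    (hu : Measurable u) {C : ℝ} (hC : ∀ x, |u x| ≤ C) :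
    Integrable u (Measure.pi fun _ : ι => μ) :=
  Integrable.of_bound hu.aestronglyMeasurable C (ae_of_all _ hC)

variable {N : ℕ} {u v : (Fin N → S) → ℝ}

lemma ae_tuple_sum_mul (hX : IsPoissonProcess X μ P) [IsFiniteMeasure μ]
    (hu : Measurable u) (hv : Measurable v)
    (hus : ∀ (σ : Equiv.Perm (Fin N)) x, u (fun i => x (σ i)) = u x)
    (hvs : ∀ (σ : Equiv.Perm (Fin N)) x, v (fun i => x (σ i)) = v x) :
    ∀ᵐ ω ∂P, (∫ x, u x ∂(tupleMeasure (Fin N) (X ω))) * (∫ x, v x ∂(tupleMeasure (Fin N) (X ω)))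
      = ∑ l : Fin (N + 1), ((N ! : ℝ) ^ 2 / ((l : ℕ)! * ((N - l)! : ℝ) ^ 2)) *
          ∫ z, u (fun i => z (fstIdx (l := l) (by omega) (by omega) i)) *
            v (fun i => z (sndIdx (l := l) (by omega) (by omega) i))
            ∂(tupleMeasure (Fin (2 * N - l)) (X ω)) := by
  filter_upwards [hX.ae_finite] with ω hω
  rw [integral_tupleMeasure hω hu, integral_tupleMeasure hω hv,
    sum_injTuples_mul_sum_injTuples hus hvs]
  refine Finset.sum_congr rfl fun l _ => ?_
  rw [integral_tupleMeasure hω (by fun_prop)]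

/-- By the overlap identity the square is a finite combination of tuple sums with bounded kernels,
each of which is integrable because its intensity measure is finite. -/
lemma IsPoissonProcess.memLp_tuple_sum (hX : IsPoissonProcess X μ P) [IsFiniteMeasure μ]
    (hu : Measurable u) {C : ℝ} (hC : ∀ x, |u x| ≤ C)
    (hus : ∀ (σ : Equiv.Perm (Fin N)) x, u (fun i => x (σ i)) = u x) :
    MemLp (fun ω => ∫ x, u x ∂(tupleMeasure (Fin N) (X ω))) 2 P := by
  have hint := hX.integrable_tuple_sum (integrable_pi_of_bounded hu hC)
  rw [memLp_two_iff_integrable_sq hint.aestronglyMeasurable]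
  have h := ae_tuple_sum_mul hX hu hu hus hus
  simp_rw [sq]
  refine Integrable.congr ?_ (h.mono fun ω hω => hω.symm)
  refine integrable_finsetSum _ fun l _ => Integrable.const_mul ?_ _
  exact hX.integrable_tuple_sum (integrable_pi_of_bounded (by fun_prop) (abs_mul_comp_le hC hC _ _))

/-- Two tuples without common points fill all `2 * N` positions; hence the disjoint term of the
second moment factors. -/
lemma bijective_sum_idx :
    Function.Bijective (Sum.elim (fstIdx (N := N) (M := 2 * N - 0) (l := 0) (by omega) (by omega))
      (sndIdx (N := N) (M := 2 * N - 0) (l := 0) (by omega) (by omega))) := by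
  constructor
  · refine (fstIdx_injective _ _).sumElim (sndIdx_injective _ _) fun i j h => ?_
    have h1 := (mem_range_fstIdx (l := 0) (N := N) (M := 2 * N - 0) (by omega) (by omega) _).1
      ⟨i, rfl⟩
    have h2 := (mem_range_sndIdx (l := 0) (N := N) (M := 2 * N - 0) (by omega) (by omega) _).1
      ⟨j, rfl⟩
    rw [h] at h1
    omega
  · intro j
    by_cases hj : (j : ℕ) < N
    · obtain ⟨i, hi⟩ := (mem_range_fstIdx (l := 0) (N := N) (M := 2 * N - 0)
        (by omega) (by omega) j).2 hj
      exact ⟨Sum.inl i, hi⟩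
    · obtain ⟨i, hi⟩ := (mem_range_sndIdx (l := 0) (N := N) (M := 2 * N - 0)
        (by omega) (by omega) j).2 (by omega)
      exact ⟨Sum.inr i, hi⟩

/-- The covariance of two sums over tuples of points of a Poisson process. -/
lemma IsPoissonProcess.covariance_tuple_sum (hX : IsPoissonProcess X μ P) [IsFiniteMeasure μ]
    [IsProbabilityMeasure P] (hu : Measurable u) (hv : Measurable v)
    {C C' : ℝ} (hC : ∀ x, |u x| ≤ C) (hC' : ∀ x, |v x| ≤ C')
    (hus : ∀ (σ : Equiv.Perm (Fin N)) x, u (fun i => x (σ i)) = u x)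
    (hvs : ∀ (σ : Equiv.Perm (Fin N)) x, v (fun i => x (σ i)) = v x) :
    covariance (fun ω => ∫ x, u x ∂(tupleMeasure (Fin N) (X ω)))
      (fun ω => ∫ x, v x ∂(tupleMeasure (Fin N) (X ω))) P
      = ∑ l : Fin N, ((N ! : ℝ) ^ 2 / ((l + 1 : ℕ)! * ((N - (l + 1))! : ℝ) ^ 2)) *
          ∫ z, u (fun i => z (fstIdx (l := l + 1) (by omega) (by omega) i)) *
            v (fun i => z (sndIdx (l := l + 1) (by omega) (by omega) i))
            ∂(Measure.pi fun _ : Fin (2 * N - (l + 1)) => μ) := by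
  have hint : ∀ {M : ℕ} (a b : Fin N → Fin M), Integrable
      (fun z : Fin M → S => u (fun i => z (a i)) * v (fun i => z (b i)))
      (Measure.pi fun _ => μ) := fun a b =>
    integrable_pi_of_bounded (by fun_prop) (abs_mul_comp_le hC hC' _ _)
  rw [covariance_eq_sub (hX.memLp_tuple_sum hu hC hus) (hX.memLp_tuple_sum hv hC' hvs)]
  simp only [Pi.mul_apply]
  rw [integral_congr_ae (ae_tuple_sum_mul hX hu hv hus hvs),
    integral_finsetSum _ fun l _ => (hX.integrable_tuple_sum (hint _ _)).const_mul _,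
    Fin.sum_univ_succ]
  simp_rw [integral_const_mul]
  rw [hX.integral_tuple_sum (integrable_pi_of_bounded hu hC),
    hX.integral_tuple_sum (integrable_pi_of_bounded hv hC'),
    hX.integral_tuple_sum (hint _ _)]
  have h0 := integral_mul_comp_pair (μ := μ) (bijective_sum_idx (N := N)) hu hv
  have hN : (N ! : ℝ) ≠ 0 := Nat.cast_ne_zero.2 (Nat.factorial_ne_zero _)
  have h1 : (N ! : ℝ) ^ 2 / (((0 : Fin (N + 1)) : ℕ)! * ((N - ((0 : Fin (N + 1)) : ℕ))! : ℝ) ^ 2)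
      = 1 := by
    simp [hN]
  -- The term `l = 0` has coefficient one and cancels the product of the means.
  rw [h1, one_mul]
  refine Eq.trans (congrArg₂ _ (congrArg₂ _ h0 rfl) rfl) ?_
  rw [add_sub_cancel_left]
  refine Finset.sum_congr rfl fun l _ => ?_
  rw [hX.integral_tuple_sum (hint _ _)]
  rfl

end Moments

/-! ### The `U`-statistic of a finite set -/

lemma prod_indicator_one {ι V : Type*} [Fintype ι] (K : ι → Set V) (z : ι → V) :
    ∏ i, (K i).indicator (fun _ => (1 : ℝ)) (z i)
      = (Set.univ.pi K).indicator (fun _ => (1 : ℝ)) z := by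
  classical
  simp [Set.indicator_apply, Finset.prod_boole]

/-- The restriction to `A` moves from the point set into the kernel, so that the moment formulas for
the whole process apply. -/
lemma uStat_inter_eq {d k : ℕ} {kern : (Fin (k + 1) → E d) → ℝ} (hk : Measurable kern)
    {Y A : Set (E d)} (hY : Y.Finite) (hA : MeasurableSet A) :
    uStat kern (Y ∩ A) = (1 / ((k + 1)! : ℝ)) *
      ∫ x, kern x * ∏ i, A.indicator (fun _ => (1 : ℝ)) (x i)
        ∂(tupleMeasure (Fin (k + 1)) Y) := by
  classical
  have hm : Measurable fun x : Fin (k + 1) → E d =>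
      kern x * ∏ i, A.indicator (fun _ => (1 : ℝ)) (x i) :=
    hk.mul (Finset.measurable_fun_prod _ fun i _ =>
      (measurable_const.indicator hA).comp (measurable_pi_apply i))
  rw [uStat, integral_tupleMeasure hY hm]
  congr 1
  have hfin : {x : Fin (k + 1) → E d | Function.Injective x ∧ ∀ i, x i ∈ Y ∩ A}
      = ((injTuples (Fin (k + 1)) hY.toFinset).filter fun x => ∀ i, x i ∈ A : Finset _) := by
    ext x
    simp [mem_injTuples, forall_and, and_assoc]
  have h2 : ∀ s : Set (Fin (k + 1) → E d),
      s = ((injTuples (Fin (k + 1)) hY.toFinset).filter fun x => ∀ i, x i ∈ A : Finset _) →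
      ∑' x : s, kern x = ∑ x ∈ (injTuples (Fin (k + 1)) hY.toFinset).filter
        (fun x => ∀ i, x i ∈ A), kern x := by
    rintro s rfl
    exact Finset.tsum_subtype _ _
  refine (h2 _ hfin).trans ?_
  rw [Finset.sum_filter]
  refine Finset.sum_congr rfl fun x _ => ?_
  rw [prod_indicator_one fun _ => A]
  simp [Set.indicator_apply]

/-! ### Regularly varying monotone functions -/

section RegularVariation

variable {g : ℝ → ℝ} {α : ℝ}

/-- Monotonicity replaces locally uniform convergence: `g (t n * s n)` is compared with `g (t n *
b)` for a fixed `b` slightly above or below `s₀`, and `b ^ (-α)` is close to `s₀ ^ (-α)`. -/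
lemma RegularlyVarying.tendsto_of_antitone (hRV : RegularlyVarying g (-α))
    (hpos : ∀ s, 0 ≤ s → 0 < g s) (hanti : AntitoneOn g (Set.Ici 0)) {t s : ℕ → ℝ} {s₀ : ℝ}
    (ht : Tendsto t atTop atTop) (hs : Tendsto s atTop (𝓝 s₀)) (hs₀ : 0 < s₀) :
    Tendsto (fun n => g (t n * s n) / g (t n)) atTop (𝓝 (s₀ ^ (-α))) := by
  have hcont : ContinuousAt (fun x : ℝ => x ^ (-α)) s₀ :=
    Real.continuousAt_rpow_const _ _ (Or.inl hs₀.ne')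
  have htp := ht.eventually_ge_atTop 0
  refine tendsto_order.2 ⟨fun c hc => ?_, fun c hc => ?_⟩
  · have h1 : ∀ᶠ b in 𝓝[>] s₀, c < b ^ (-α) :=
      (hcont.eventually (lt_mem_nhds hc)).filter_mono nhdsWithin_le_nhds
    obtain ⟨b, hb, hsb⟩ := (h1.and self_mem_nhdsWithin).exists
    have hb0 : 0 < b := hs₀.trans hsb
    filter_upwards [((hRV b hb0).comp ht).eventually (lt_mem_nhds hb), hs.eventually (gt_mem_nhds hsb),
      hs.eventually (lt_mem_nhds hs₀), htp] with n h1 h2 h3 h4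
    refine h1.trans_le ?_
    simp only [Function.comp_apply]
    have := (hpos _ h4).le
    gcongr
    exact hanti (Set.mem_Ici.2 (by positivity)) (Set.mem_Ici.2 (by positivity)) (by gcongr)
  · have h1 : ∀ᶠ b in 𝓝[<] s₀, b ^ (-α) < c ∧ 0 < b :=
      ((hcont.eventually (gt_mem_nhds hc)).and (lt_mem_nhds hs₀)).filter_mono nhdsWithin_le_nhds
    obtain ⟨b, ⟨hb, hb0⟩, hsb⟩ := (h1.and self_mem_nhdsWithin).exists
    filter_upwards [((hRV b hb0).comp ht).eventually (gt_mem_nhds hb), hs.eventually (lt_mem_nhds hsb),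
      htp] with n h1 h2 h4
    refine lt_of_le_of_lt ?_ h1
    simp only [Function.comp_apply]
    have := (hpos _ h4).le
    have h5 : 0 < s n := hb0.trans h2
    gcongr
    exact hanti (Set.mem_Ici.2 (by positivity)) (Set.mem_Ici.2 (by positivity)) (by gcongr)

/-- A Potter bound for monotone regularly varying functions. -/
lemma RegularlyVarying.potter (hRV : RegularlyVarying g (-α))
    (hpos : ∀ s, 0 ≤ s → 0 < g s) (hanti : AntitoneOn g (Set.Ici 0)) {β : ℝ} (hβ : 0 ≤ β)
    (hβα : β < α) :
    ∀ᶠ t in atTop, ∀ s, 1 ≤ s → g (t * s) / g t ≤ 2 ^ β * s ^ (-β) := by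
  have h2 : (2 : ℝ) ^ (-α) < 2 ^ (-β) := Real.rpow_lt_rpow_of_exponent_lt one_lt_two (by linarith)
  obtain ⟨t₀, ht₀⟩ := eventually_atTop.1 ((hRV 2 two_pos).eventually (gt_mem_nhds h2))
  filter_upwards [eventually_ge_atTop (max t₀ 1)] with t ht s hs
  have htt : t₀ ≤ t := (le_max_left _ _).trans ht
  have ht1 : 1 ≤ t := (le_max_right _ _).trans ht
  have hstep : ∀ m : ℕ, g (t * 2 ^ m) ≤ ((2 : ℝ) ^ (-β)) ^ m * g t := by
    intro m
    induction m with
    | zero => simp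
    | succ m ih =>
      have hp : (1 : ℝ) ≤ 2 ^ m := one_le_pow₀ one_le_two
      have h3 := ht₀ (t * 2 ^ m) (by nlinarith)
      rw [div_lt_iff₀ (hpos _ (by positivity))] at h3
      calc g (t * 2 ^ (m + 1)) = g (t * 2 ^ m * 2) := by ring_nf
        _ ≤ 2 ^ (-β) * g (t * 2 ^ m) := h3.le
        _ ≤ 2 ^ (-β) * (((2 : ℝ) ^ (-β)) ^ m * g t) := by gcongr
        _ = _ := by ring
  obtain ⟨m, hm1, hm2⟩ := exists_nat_pow_near hs (one_lt_two (α := ℝ))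
  have h4 : g (t * s) ≤ g (t * 2 ^ m) :=
    hanti (Set.mem_Ici.2 (by positivity)) (Set.mem_Ici.2 (by positivity)) (by gcongr)
  rw [div_le_iff₀ (hpos _ (by positivity))]
  refine (h4.trans (hstep m)).trans ?_
  have := (hpos t (by positivity)).le
  gcongr
  have h5 : s ^ β ≤ 2 ^ β * ((2 : ℝ) ^ m) ^ β := by
    rw [← Real.mul_rpow (by positivity) (by positivity)]
    refine Real.rpow_le_rpow (by positivity) ?_ hβ
    rw [← pow_succ']
    exact hm2.le
  have h6 : ((2 : ℝ) ^ (-β)) ^ m = (((2 : ℝ) ^ m) ^ β)⁻¹ := by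
    rw [Real.rpow_neg two_pos.le, inv_pow, ← Real.rpow_mul_natCast two_pos.le, mul_comm,
      Real.rpow_natCast_mul two_pos.le]
  have hs0 : 0 < s ^ β := Real.rpow_pos_of_pos (by linarith) _
  rw [h6, Real.rpow_neg (by linarith), ← div_eq_mul_inv, le_div_iff₀ hs0, inv_mul_le_iff₀
    (by positivity), mul_comm]
  exact h5

end RegularVariation

/-! ### Densities on product spaces -/

lemma pi_withDensity_ofReal {S ι : Type*} [MeasurableSpace S] [Fintype ι] {ν : Measure S}
    [SigmaFinite ν] {f : S → ℝ} (hf : Integrable f ν) (hf0 : ∀ x, 0 ≤ f x) :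
    Measure.pi (fun _ : ι => ν.withDensity fun x => ENNReal.ofReal (f x))
      = (Measure.pi fun _ : ι => ν).withDensity fun z => ENNReal.ofReal (∏ i, f (z i)) := by
  have : IsFiniteMeasure (ν.withDensity fun x => ENNReal.ofReal (f x)) :=
    isFiniteMeasure_withDensity_ofReal hf.2
  refine Measure.pi_eq fun B hB => ?_
  rw [withDensity_apply _ (MeasurableSet.univ_pi hB), Measure.restrict_pi_pi,
    ← ofReal_integral_eq_lintegral_ofReal
      (Integrable.fintype_prod (f := fun _ : ι => f) fun i => hf.restrict)
      (ae_of_all _ fun z => Finset.prod_nonneg fun i _ => hf0 _),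
    integral_fintype_prod_eq_prod (f := fun _ : ι => f),
    ENNReal.ofReal_prod_of_nonneg fun i _ => integral_nonneg hf0]
  refine Finset.prod_congr rfl fun i _ => ?_
  rw [withDensity_apply _ (hB i), ← ofReal_integral_eq_lintegral_ofReal hf.restrict
    (ae_of_all _ hf0)]

lemma integral_pi_withDensity_ofReal {S ι : Type*} [MeasurableSpace S] [Fintype ι] {ν : Measure S}
    [SigmaFinite ν] {f : S → ℝ} (hf : Integrable f ν) (hfm : Measurable f) (hf0 : ∀ x, 0 ≤ f x)
    (u : (ι → S) → ℝ) :
    ∫ z, u z ∂(Measure.pi fun _ : ι => ν.withDensity fun x => ENNReal.ofReal (f x))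
      = ∫ z, u z * ∏ i, f (z i) ∂(Measure.pi fun _ : ι => ν) := by
  rw [pi_withDensity_ofReal hf hf0, integral_withDensity_eq_integral_toReal_smul (by fun_prop)
    (ae_of_all _ fun _ => ENNReal.ofReal_lt_top)]
  refine integral_congr_ae (ae_of_all _ fun z => ?_)
  simp only [smul_eq_mul]
  rw [ENNReal.toReal_ofReal (Finset.prod_nonneg fun i _ => hf0 _), mul_comm]

/-! ### A change of variables -/

lemma measurePreserving_smul_add {V : Type*} [NormedAddCommGroup V] [NormedSpace ℝ V]
    [FiniteDimensional ℝ V] [MeasurableSpace V] [BorelSpace V] (ν : Measure V)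
    [ν.IsAddHaarMeasure] {r : ℝ} (hr : 0 < r) (a : V) :
    Measure.map (fun y => a + r • y) ν
      = ENNReal.ofReal ((r ^ Module.finrank ℝ V)⁻¹) • ν := by
  have : (fun y : V => a + r • y) = (fun y => a + y) ∘ fun y => r • y := rfl
  rw [this, ← Measure.map_map (measurable_const_add a) (measurable_const_smul r),
    Measure.map_addHaar_smul ν hr.ne', Measure.map_smul, map_add_left_eq_self,
    abs_of_pos (by positivity)]

/-- Substitution `z₀ = t x`, `zᵢ = t x + r yᵢ`: the Jacobian is `t ^ d` from the base point and `r ^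
d` from each of the `m` others. -/
lemma integral_fin_succ_eq_integral_scaled {d m : ℕ} {F : (Fin (m + 1) → E d) → ℝ}
    (hF : Measurable F) {t r : ℝ} (ht : 0 < t) (hr : 0 < r) :
    ∫ z, F z = t ^ d * r ^ (d * m) *
      ∫ q : E d × (Fin m → E d), F (Fin.cons (t • q.1) fun i => t • q.1 + r • q.2 i) := by
  have h1 := (volume_preserving_piFinSuccAbove (fun _ : Fin (m + 1) => E d) 0).symm
  have hcons : ∀ q : E d × (Fin m → E d),
      (MeasurableEquiv.piFinSuccAbove (fun _ : Fin (m + 1) => E d) 0).symm q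
        = (Fin.cons q.1 q.2 : Fin (m + 1) → E d) := fun q => by
    simp [MeasurableEquiv.piFinSuccAbove_symm_apply, Fin.insertNthEquiv, Fin.insertNth_zero']
  have hcm : Measurable fun q : E d × (Fin m → E d) => (Fin.cons q.1 q.2 : Fin (m + 1) → E d) := by
    simp_rw [← hcons]
    exact h1.measurable
  have h2 : ∫ z, F z = ∫ q : E d × (Fin m → E d), F (Fin.cons q.1 q.2) := by
    rw [← h1.integral_comp']
    simp_rw [hcons]
  -- The map is a skew product: for fixed `x`, the fibre map in `y` is a dilation by `r` followed by
  -- a translation.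
  have h3 : MeasurePreserving (fun q : E d × (Fin m → E d) =>
      (t • q.1, (fun _ => t • q.1) + r • q.2)) (volume.prod volume)
      ((ENNReal.ofReal ((t ^ d)⁻¹) • volume).prod (ENNReal.ofReal ((r ^ (d * m))⁻¹) • volume)) := by
    refine MeasurePreserving.skew_product (f := fun x : E d => t • x)
      (g := fun x y => (fun _ => t • x) + r • y) ⟨by fun_prop, ?_⟩ (by fun_prop)
      (ae_of_all _ fun x => ?_)
    · have := measurePreserving_smul_add (volume : Measure (E d)) ht 0
      simpa using this
    · have := measurePreserving_smul_add (volume : Measure (Fin m → E d)) hr (fun _ => t • x)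
      rw [this, Module.finrank_pi_fintype]
      simp [mul_comm]
  have h4 : ∫ q : E d × (Fin m → E d), F (Fin.cons (t • q.1) fun i => t • q.1 + r • q.2 i)
      = (t ^ d)⁻¹ * (r ^ (d * m))⁻¹ * ∫ q : E d × (Fin m → E d), F (Fin.cons q.1 q.2) := by
    have h5 := integral_map (μ := volume.prod volume) h3.measurable.aemeasurable
      (f := fun q : E d × (Fin m → E d) => F (Fin.cons q.1 q.2))
      (hF.comp hcm).aestronglyMeasurable
    rw [h3.map_eq, Measure.prod_smul_left, Measure.prod_smul_right, integral_smul_measure,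
      integral_smul_measure, ENNReal.toReal_ofReal (by positivity),
      ENNReal.toReal_ofReal (by positivity), smul_eq_mul, smul_eq_mul] at h5
    rw [mul_assoc]
    exact h5.symm
  rw [h4, h2]
  have := ht.ne'
  have := hr.ne'
  field_simp

/-! ### The asymptotics of local integrals far from the origin -/

/-- A continuous, positively homogeneous function comparable to the norm. -/
structure IsGaugeLike {d : ℕ} (G : E d → ℝ) : Prop where
  continuous : Continuous G
  nonneg : ∀ x, 0 ≤ G x
  smul : ∀ t : ℝ, 0 ≤ t → ∀ x, G (t • x) = t * G x
  norm_le : ∃ R : ℝ, 0 < R ∧ ∀ x, ‖x‖ ≤ R * G x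

/-- A bounded measurable translation invariant kernel of bounded range. -/
structure IsLocalWeight {d m : ℕ} (w : (Fin (m + 1) → E d) → ℝ) : Prop where
  measurable : Measurable w
  nonneg : ∀ x, 0 ≤ w x
  bounded : ∃ C : ℝ, ∀ x, w x ≤ C
  translation : ∀ (y : E d) (x : Fin (m + 1) → E d), w (fun i => x i + y) = w x
  range : ∃ κ : ℝ, ∀ x, w x ≠ 0 → ∀ i, ‖x i - x 0‖ ≤ κ

section Limit

variable {d m : ℕ} {G : E d → ℝ} {g : ℝ → ℝ} {w : (Fin (m + 1) → E d) → ℝ}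
  {K : Fin (m + 1) → Set (E d)} {α : ℝ}

lemma IsGaugeLike.measurable_comp (hG : IsGaugeLike G) (hanti : AntitoneOn g (Set.Ici 0)) :
    Measurable fun x => g (G x) := by
  -- Monotonicity holds only on `[0, ∞)`; truncating the argument gives a globally antitone, hence
  -- measurable, function.
  have h : Antitone fun s => g (max 0 s) := fun a b hab =>
    hanti (Set.mem_Ici.2 (le_max_left _ _)) (Set.mem_Ici.2 (le_max_left _ _))
      (max_le_max le_rfl hab)
  have h2 : (fun x => g (G x)) = (fun s => g (max 0 s)) ∘ G := by
    funext x
    simp [max_eq_right (hG.nonneg x)]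
  rw [h2]
  exact h.measurable.comp hG.continuous.measurable

lemma measurable_finCons {d m : ℕ} :
    Measurable fun q : E d × (Fin m → E d) => (Fin.cons q.1 q.2 : Fin (m + 1) → E d) := by
  refine measurable_pi_lambda _ fun i => ?_
  refine Fin.cases ?_ (fun j => ?_) i
  · simpa using measurable_fst
  · simp only [Fin.cons_succ]
    fun_prop

lemma measurable_finCons_zero {d m : ℕ} :
    Measurable fun y : Fin m → E d => (Fin.cons 0 y : Fin (m + 1) → E d) :=
  measurable_finCons.comp (measurable_const.prodMk measurable_id)

lemma continuous_finCons_zero {d m : ℕ} (i : Fin (m + 1)) :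
    Continuous fun y : Fin m → E d => (Fin.cons 0 y : Fin (m + 1) → E d) i := by
  refine Fin.cases ?_ (fun j => ?_) i
  · simpa using continuous_const
  · simpa using continuous_apply j

lemma IsGaugeLike.integrable_rpow (hG : IsGaugeLike G) {β : ℝ} (hβ : (d : ℝ) < β) :
    Integrable fun x => ({x | 1 ≤ G x} : Set (E d)).indicator (fun x => G x ^ (-β)) x := by
  obtain ⟨R, hR, hn⟩ := hG.norm_le
  -- Where `1 ≤ G x`, one has `1 + ‖x‖ ≤ (1 + R) * G x`, which gives the constant.
  have h1 : Integrable fun x : E d => (1 + R) ^ β * (1 + ‖x‖) ^ (-β) :=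
    (integrable_one_add_norm (by simpa using hβ)).const_mul _
  have hmeas : MeasurableSet {x | 1 ≤ G x} :=
    measurableSet_le measurable_const hG.continuous.measurable
  refine h1.mono' (((hG.continuous.measurable.pow_const _).indicator hmeas).aestronglyMeasurable)
    (ae_of_all _ fun x => ?_)
  have hβ0 : 0 ≤ β := (Nat.cast_nonneg d).trans hβ.le
  have hpos : 0 < 1 + ‖x‖ := by positivity
  rw [Real.norm_eq_abs, abs_of_nonneg (Set.indicator_nonneg (fun y _ =>
    Real.rpow_nonneg (hG.nonneg y) _) _)]
  by_cases hx : 1 ≤ G x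
  · rw [Set.indicator_of_mem (by exact hx), Real.rpow_neg hpos.le, Real.rpow_neg (hG.nonneg x),
      ← div_eq_mul_inv, ← Real.div_rpow (by positivity) hpos.le,
      ← Real.inv_rpow (hG.nonneg x)]
    refine Real.rpow_le_rpow (inv_nonneg.2 (hG.nonneg x)) ?_ hβ0
    rw [inv_eq_one_div, div_le_div_iff₀ (by linarith) hpos]
    have := hn x
    nlinarith
  · rw [Set.indicator_of_notMem (by exact hx)]
    positivity

/-- A dominating function for the rescaled integrands. -/
lemma exists_dominating (hG : IsGaugeLike G) (hw : IsLocalWeight w) {β : ℝ} (hβ : (d : ℝ) < β) :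
    ∃ B : E d × (Fin m → E d) → ℝ, Integrable B ∧ (∀ q, 0 ≤ B q) ∧
      ∀ q, 1 ≤ G q.1 → w (Fin.cons 0 q.2) * (2 ^ β * G q.1 ^ (-β)) ≤ B q := by
  obtain ⟨C, hC⟩ := hw.bounded
  obtain ⟨κ, hκ⟩ := hw.range
  have hC0 : 0 ≤ C := (hw.nonneg 0).trans (hC 0)
  have hball : Integrable fun y : Fin m → E d =>
      (Metric.closedBall (0 : Fin m → E d) |κ|).indicator (fun _ => C * 2 ^ β) y := by
    rw [integrable_indicator_iff Metric.isClosed_closedBall.measurableSet]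
    exact integrableOn_const (isCompact_closedBall _ _).measure_lt_top.ne
  refine ⟨fun q => ({x | 1 ≤ G x} : Set (E d)).indicator (fun x => G x ^ (-β)) q.1 *
    (Metric.closedBall (0 : Fin m → E d) |κ|).indicator (fun _ => C * 2 ^ β) q.2,
    (hG.integrable_rpow hβ).mul_prod hball, fun q => mul_nonneg
      (Set.indicator_nonneg (fun y _ => Real.rpow_nonneg (hG.nonneg y) _) _)
      (Set.indicator_nonneg (fun y _ => by positivity) _), fun q hq => ?_⟩
  simp only []
  rw [Set.indicator_of_mem (by exact hq)]
  have hGp := Real.rpow_nonneg (hG.nonneg q.1) (-β)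
  by_cases h0 : w (Fin.cons 0 q.2) = 0
  · rw [h0, zero_mul]
    exact mul_nonneg hGp (Set.indicator_nonneg (fun y _ => by positivity) _)
  · have hmem : q.2 ∈ Metric.closedBall (0 : Fin m → E d) |κ| := by
      rw [mem_closedBall_zero_iff, pi_norm_le_iff_of_nonneg (abs_nonneg _)]
      intro i
      have := hκ _ h0 i.succ
      simp only [Fin.cons_succ, Fin.cons_zero, sub_zero] at this
      exact this.trans (le_abs_self _)
    rw [Set.indicator_of_mem hmem]
    calc w (Fin.cons 0 q.2) * (2 ^ β * G q.1 ^ (-β)) ≤ C * (2 ^ β * G q.1 ^ (-β)) := by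
          gcongr
          exact hC _
      _ = _ := by ring

lemma measurable_indicator_one {A : Type*} [MeasurableSpace A] {H : Set (E d)}
    (hH : MeasurableSet H) {p : A → E d} (hp : Measurable p) :
    Measurable fun a => H.indicator (fun _ => (1 : ℝ)) (p a) :=
  (measurable_const.indicator hH).comp hp

/-- Since `G ≥ 1` on `H`, the exponent `α * (m + 1)` may be weakened to `α`, and `α > d` suffices.
-/
lemma integrable_limit (hG : IsGaugeLike G) (hw : IsLocalWeight w) {H : Set (E d)}
    (hH : MeasurableSet H) (hH1 : ∀ x ∈ H, 1 ≤ G x) (hα : (d : ℝ) < α) :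
    Integrable fun q : E d × (Fin m → E d) => w (Fin.cons 0 q.2) *
      H.indicator (fun _ => (1 : ℝ)) q.1 * G q.1 ^ (-(α * ((m : ℝ) + 1))) := by
  obtain ⟨B, hB, hB0, hle⟩ := exists_dominating hG hw hα
  have hα0 : 0 ≤ α := (Nat.cast_nonneg d).trans hα.le
  refine hB.mono' (Measurable.aestronglyMeasurable ?_) (ae_of_all _ fun q => ?_)
  · exact ((hw.measurable.comp (measurable_finCons_zero.comp measurable_snd)).mul
      (measurable_indicator_one hH measurable_fst)).mul
      ((hG.continuous.measurable.comp measurable_fst).pow_const _)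
  · have hp := Real.rpow_nonneg (hG.nonneg q.1) (-(α * ((m : ℝ) + 1)))
    have hwn := hw.nonneg (Fin.cons 0 q.2)
    by_cases hq : q.1 ∈ H
    · rw [Set.indicator_of_mem hq, mul_one, Real.norm_eq_abs, abs_of_nonneg (mul_nonneg hwn hp)]
      refine le_trans ?_ (hle q (hH1 _ hq))
      gcongr
      have h1 : G q.1 ^ (-(α * ((m : ℝ) + 1))) ≤ G q.1 ^ (-α) := by
        refine Real.rpow_le_rpow_of_exponent_le (hH1 _ hq) ?_
        have : 0 ≤ α * m := by positivity
        nlinarith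
      have h2 : (1 : ℝ) ≤ 2 ^ α := Real.one_le_rpow one_le_two hα0
      have h3 := Real.rpow_nonneg (hG.nonneg q.1) (-α)
      nlinarith
    · rw [Set.indicator_of_notMem hq]
      simpa using hB0 q

/-- The integral of a local kernel against a product density, restricted to dilated sets. -/
noncomputable def localIntegral (w : (Fin (m + 1) → E d) → ℝ) (K : Fin (m + 1) → Set (E d))
    (G : E d → ℝ) (g : ℝ → ℝ) (t r : ℝ) : ℝ :=
  ∫ z : Fin (m + 1) → E d, w (fun i => r⁻¹ • z i) *
    ∏ i, ((K i).indicator (fun _ => (1 : ℝ)) (t⁻¹ • z i) * g (G (z i)))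

/-- The integrand of `localIntegral` after rescaling. -/
noncomputable def rescaledIntegrand (w : (Fin (m + 1) → E d) → ℝ) (K : Fin (m + 1) → Set (E d))
    (G : E d → ℝ) (g : ℝ → ℝ) (t ε : ℝ) (q : E d × (Fin m → E d)) : ℝ :=
  w (Fin.cons 0 q.2) * ∏ i,
    ((K i).indicator (fun _ => (1 : ℝ)) (q.1 + ε • (Fin.cons 0 q.2 : Fin (m + 1) → E d) i) *
      (g (t * G (q.1 + ε • (Fin.cons 0 q.2 : Fin (m + 1) → E d) i)) / g t))

lemma measurable_rescaledIntegrand (hG : IsGaugeLike G) (hw : IsLocalWeight w)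
    (hanti : AntitoneOn g (Set.Ici 0)) (hK : ∀ i, MeasurableSet (K i)) {t : ℝ} (ht : 0 ≤ t)
    (ε : ℝ) : Measurable (rescaledIntegrand w K G g t ε) := by
  refine (hw.measurable.comp (measurable_finCons_zero.comp measurable_snd)).mul
    (Finset.measurable_fun_prod _ fun i _ => ?_)
  have hp : Measurable fun q : E d × (Fin m → E d) =>
      q.1 + ε • (Fin.cons 0 q.2 : Fin (m + 1) → E d) i :=
    measurable_fst.add
      (((continuous_finCons_zero i).measurable.comp measurable_snd).const_smul ε)
  refine (measurable_indicator_one (hK i) hp).mul (Measurable.div_const ?_ _)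
  simp_rw [← hG.smul t ht]
  exact (hG.measurable_comp hanti).comp (hp.const_smul t)

/-- After the substitution the arguments of the weight are `(r⁻¹ * t) • x + yᵢ` with `y₀ = 0`, and
translation invariance removes `x`. Homogeneity of `G` pulls out `t`, and each density factor is
normalised by `g t`. -/
lemma localIntegral_eq (hG : IsGaugeLike G) (hw : IsLocalWeight w)
    (hanti : AntitoneOn g (Set.Ici 0)) (hK : ∀ i, MeasurableSet (K i)) {t r : ℝ} (ht : 0 < t)
    (hr : 0 < r) (hg : 0 < g t) :
    localIntegral w K G g t r
      = g t ^ (m + 1) * (t ^ d * r ^ (d * m)) * ∫ q, rescaledIntegrand w K G g t (r / t) q := by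
  have hmeas : Measurable fun z : Fin (m + 1) → E d => w (fun i => r⁻¹ • z i) *
      ∏ i, ((K i).indicator (fun _ => (1 : ℝ)) (t⁻¹ • z i) * g (G (z i))) := by
    refine (hw.measurable.comp (measurable_id.const_smul r⁻¹)).mul
      (Finset.measurable_fun_prod _ fun i _ => ?_)
    exact (measurable_indicator_one (hK i) (by fun_prop)).mul
      ((hG.measurable_comp hanti).comp (measurable_pi_apply i))
  rw [localIntegral, integral_fin_succ_eq_integral_scaled hmeas ht hr,
    mul_comm (g t ^ (m + 1)), mul_assoc (t ^ d * r ^ (d * m)), ← integral_const_mul (g t ^ (m + 1))]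
  congr 1
  refine integral_congr_ae (ae_of_all _ fun q => ?_)
  have hz : ∀ i, (Fin.cons (t • q.1) (fun i => t • q.1 + r • q.2 i) : Fin (m + 1) → E d) i
      = t • (q.1 + (r / t) • (Fin.cons 0 q.2 : Fin (m + 1) → E d) i) := by
    intro i
    rw [smul_add, smul_smul, mul_div_cancel₀ _ ht.ne']
    refine Fin.cases ?_ (fun j => ?_) i <;> simp
  have hwz : w (fun i => r⁻¹ •
      (Fin.cons (t • q.1) (fun i => t • q.1 + r • q.2 i) : Fin (m + 1) → E d) i)
      = w (Fin.cons 0 q.2) := by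
    rw [← hw.translation ((r⁻¹ * t) • q.1) (Fin.cons 0 q.2)]
    congr 1
    funext i
    rw [hz, smul_add, smul_add, smul_smul, smul_smul, smul_smul, add_comm]
    congr 1
    rw [show r⁻¹ * t * (r / t) = 1 by field_simp, one_smul]
  simp only [rescaledIntegrand]
  rw [hwz, mul_left_comm]
  congr 1
  have hpow : g t ^ (m + 1) = ∏ _i : Fin (m + 1), g t := by simp
  rw [hpow, ← Finset.prod_mul_distrib]
  refine Finset.prod_congr rfl fun i _ => ?_
  rw [hz, smul_smul, inv_mul_cancel₀ ht.ne', one_smul, hG.smul t ht.le, mul_left_comm,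
    mul_div_cancel₀ _ hg.ne']

/-- The asymptotics of `localIntegral` for regularly varying generators. -/
lemma tendsto_localIntegral (hG : IsGaugeLike G) (hw : IsLocalWeight w)
    (hα : (d : ℝ) < α) (hgpos : ∀ s, 0 ≤ s → 0 < g s) (hanti : AntitoneOn g (Set.Ici 0))
    (hRV : RegularlyVarying g (-α)) (hK : ∀ i, MeasurableSet (K i))
    (hK1 : ∀ i, ∀ x ∈ K i, 1 ≤ G x) (hconv : Convex ℝ (K 0)) (hsub : ∀ i, K 0 ⊆ K i)
    {t r : ℕ → ℝ} (ht : Tendsto t atTop atTop) (hrpos : ∀ n, 0 < r n) {r₀ : ℝ}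
    (hr : Tendsto r atTop (𝓝 r₀)) :
    Tendsto (fun n => localIntegral w K G g (t n) (r n) /
        (g (t n) ^ (m + 1) * (t n ^ d * r n ^ (d * m)))) atTop
      (𝓝 (∫ q : E d × (Fin m → E d), w (Fin.cons 0 q.2) *
        (K 0).indicator (fun _ => (1 : ℝ)) q.1 * G q.1 ^ (-(α * ((m : ℝ) + 1))))) := by
  have htpos := ht.eventually_gt_atTop 0
  have hev : ∀ᶠ n in atTop, ∫ q, rescaledIntegrand w K G g (t n) (r n / t n) q
      = localIntegral w K G g (t n) (r n) / (g (t n) ^ (m + 1) * (t n ^ d * r n ^ (d * m))) := by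
    filter_upwards [htpos] with n hn
    have h1 := hgpos _ hn.le
    have h2 := hrpos n
    rw [localIntegral_eq hG hw hanti hK hn h2 h1, mul_div_cancel_left₀]
    positivity
  refine Tendsto.congr' hev ?_
  -- The Potter bound needs `β < α`, and integrability at infinity needs `d < β`.
  obtain ⟨β, hdβ, hβα⟩ := exists_between hα
  have hβ0 : 0 ≤ β := (Nat.cast_nonneg d).trans hdβ.le
  obtain ⟨B, hB, hB0, hle⟩ := exists_dominating hG hw hdβ
  have hε : Tendsto (fun n => r n / t n) atTop (𝓝 0) := hr.div_atTop ht
  refine tendsto_integral_filter_of_dominated_convergence B ?_ ?_ hB ?_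
  · filter_upwards [htpos] with n hn
    exact (measurable_rescaledIntegrand hG hw hanti hK hn.le _).aestronglyMeasurable
  · filter_upwards [htpos, ht.eventually (hRV.potter hgpos hanti hβ0 hβα)] with n hn hpot
    refine ae_of_all _ fun q => ?_
    have hgt := hgpos _ hn.le
    have hfac0 : ∀ i, 0 ≤ (K i).indicator (fun _ => (1 : ℝ))
        (q.1 + (r n / t n) • (Fin.cons 0 q.2 : Fin (m + 1) → E d) i) *
      (g (t n * G (q.1 + (r n / t n) • (Fin.cons 0 q.2 : Fin (m + 1) → E d) i)) / g (t n)) :=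
      fun i => mul_nonneg (Set.indicator_nonneg (fun _ _ => zero_le_one) _)
        (div_nonneg (hgpos _ (mul_nonneg hn.le (hG.nonneg _))).le hgt.le)
    have hfac1 : ∀ i, (K i).indicator (fun _ => (1 : ℝ))
        (q.1 + (r n / t n) • (Fin.cons 0 q.2 : Fin (m + 1) → E d) i) *
      (g (t n * G (q.1 + (r n / t n) • (Fin.cons 0 q.2 : Fin (m + 1) → E d) i)) / g (t n)) ≤ 1 := by
      intro i
      by_cases hi : q.1 + (r n / t n) • (Fin.cons 0 q.2 : Fin (m + 1) → E d) i ∈ K i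
      · rw [Set.indicator_of_mem hi, one_mul, div_le_one hgt]
        have := hK1 i _ hi
        exact hanti (Set.mem_Ici.2 hn.le) (Set.mem_Ici.2 (mul_nonneg hn.le (hG.nonneg _)))
          (by nlinarith)
      · rw [Set.indicator_of_notMem hi, zero_mul]
        exact zero_le_one
    rw [Real.norm_eq_abs, rescaledIntegrand,
      abs_of_nonneg (mul_nonneg (hw.nonneg _) (Finset.prod_nonneg fun i _ => hfac0 i))]
    by_cases hq : q.1 ∈ K 0
    · have hq1 := hK1 0 _ hq
      refine le_trans ?_ (hle q hq1)
      refine mul_le_mul_of_nonneg_left ?_ (hw.nonneg _)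
      -- Only the base point is charged with the Potter bound; all other factors are at most `1`.
      rw [Fin.prod_univ_succ]
      refine (mul_le_of_le_one_right (hfac0 0)
        (Finset.prod_le_one (fun i _ => hfac0 _) fun i _ => hfac1 _)).trans ?_
      simp only [Fin.cons_zero, smul_zero, add_zero]
      rw [Set.indicator_of_mem hq, one_mul]
      exact hpot _ hq1
    · rw [Finset.prod_eq_zero (Finset.mem_univ 0), mul_zero]
      · exact hB0 q
      · simp [Set.indicator_of_notMem hq]
  -- The frontier of a convex set is Lebesgue null. Off it, the indicators are eventually constant
  -- along the points that converge to `q.1`.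
  · have hfront : ∀ᵐ q : E d × (Fin m → E d), q.1 ∉ frontier (K 0) := by
      have h0 : ∀ᵐ x : E d, x ∉ frontier (K 0) := by
        rw [ae_iff]
        simpa using hconv.addHaar_frontier volume
      exact Measure.quasiMeasurePreserving_fst.ae h0
    filter_upwards [hfront] with q hq
    have hlimp : ∀ i, Tendsto (fun n => q.1 + (r n / t n) •
        (Fin.cons 0 q.2 : Fin (m + 1) → E d) i) atTop (𝓝 q.1) := by
      intro i
      simpa using tendsto_const_nhds.add
        (hε.smul_const ((Fin.cons 0 q.2 : Fin (m + 1) → E d) i))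
    by_cases hqK : q.1 ∈ K 0
    · have hint : q.1 ∈ interior (K 0) := by
        by_contra h
        exact hq ⟨subset_closure hqK, h⟩
      have hnhds : K 0 ∈ 𝓝 q.1 := mem_interior_iff_mem_nhds.1 hint
      have hpos : 0 < G q.1 := zero_lt_one.trans_le (hK1 0 _ hqK)
      have hprod : Tendsto (fun n => ∏ i, ((K i).indicator (fun _ => (1 : ℝ))
            (q.1 + (r n / t n) • (Fin.cons 0 q.2 : Fin (m + 1) → E d) i) *
          (g (t n * G (q.1 + (r n / t n) • (Fin.cons 0 q.2 : Fin (m + 1) → E d) i)) / g (t n))))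
          atTop (𝓝 (∏ _i : Fin (m + 1), (1 * G q.1 ^ (-α)))) := by
        refine tendsto_finsetProd _ fun i _ => Tendsto.mul ?_ ?_
        · refine tendsto_const_nhds.congr' ?_
          filter_upwards [(hlimp i).eventually hnhds] with n hn
          rw [Set.indicator_of_mem (hsub i hn)]
        · exact hRV.tendsto_of_antitone hgpos hanti ht
            ((hG.continuous.tendsto _).comp (hlimp i)) hpos
      have hval : w (Fin.cons 0 q.2) * (K 0).indicator (fun _ => (1 : ℝ)) q.1 *
          G q.1 ^ (-(α * ((m : ℝ) + 1)))
          = w (Fin.cons 0 q.2) * ∏ _i : Fin (m + 1), (1 * G q.1 ^ (-α)) := by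
        rw [Set.indicator_of_mem hqK]
        simp only [one_mul, mul_one, Finset.prod_const, Finset.card_univ, Fintype.card_fin]
        rw [← Real.rpow_mul_natCast hpos.le]
        push_cast
        ring_nf
      rw [hval]
      exact hprod.const_mul _
    -- The factor of index `0` is evaluated at `q.1` itself, so here the rescaled integrand vanishes
    -- for every `n`.
    · rw [Set.indicator_of_notMem hqK, mul_zero, zero_mul]
      refine tendsto_const_nhds.congr fun n => ?_
      rw [rescaledIntegrand, Finset.prod_eq_zero (Finset.mem_univ 0), mul_zero]
      simp [Set.indicator_of_notMem hqK]

end Limit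

/-! ### Gauges and halfspaces -/

section Geometry

variable {d : ℕ} {D : Set (E d)}

lemma isGaugeLike_gauge (hDopen : IsOpen D) (hDconv : Convex ℝ D)
    (hDbdd : Bornology.IsBounded D) (hD0 : (0 : E d) ∈ D) : IsGaugeLike (gauge D) where
  continuous := continuous_gauge hDconv (hDopen.mem_nhds hD0)
  nonneg := gauge_nonneg
  smul t ht x := by rw [gauge_smul_of_nonneg ht, smul_eq_mul]
  norm_le := by
    obtain ⟨R, hR⟩ := hDbdd.subset_closedBall 0
    have hR1 : 0 < max R 1 := lt_max_of_lt_right one_pos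
    refine ⟨max R 1, hR1, fun x => ?_⟩
    have := le_gauge_of_subset_closedBall (x := x)
      (absorbent_nhds_zero (hDopen.mem_nhds hD0)) hR1.le
      (hR.trans (Metric.closedBall_subset_closedBall (le_max_left _ _)))
    rwa [div_le_iff₀' hR1] at this

/-- Since `D` is open, the support value is not attained: from a point of `D` in the halfspace, a
small step along `θ` would stay in `D` and exceed the supremum. So the halfspace misses `D`, where
the gauge is less than one. -/
lemma one_le_gauge_of_mem_halfspace (hDopen : IsOpen D) (hDconv : Convex ℝ D)
    (hDbdd : Bornology.IsBounded D) (hD0 : (0 : E d) ∈ D) {θ : E d} (hθ : ‖θ‖ = 1)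
    {x : E d} (hx : x ∈ halfspace D θ) : 1 ≤ gauge D x := by
  refine one_le_gauge_of_notMem (hDconv.starConvex hD0)
    (absorbent_nhds_zero (hDopen.mem_nhds hD0) x) fun hxD => ?_
  have hcont : Tendsto (fun ε : ℝ => x + ε • θ) (𝓝[>] 0) (𝓝 x) := by
    have : Continuous fun ε : ℝ => x + ε • θ := by fun_prop
    simpa using (this.tendsto 0).mono_left nhdsWithin_le_nhds
  obtain ⟨ε, hε, hε0⟩ := ((hcont.eventually (hDopen.mem_nhds hxD)).and self_mem_nhdsWithin).exists
  have hbdd : BddAbove ((fun x : E d => inner ℝ x θ) '' D) := by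
    obtain ⟨R, hR⟩ := hDbdd.subset_closedBall 0
    refine ⟨R, ?_⟩
    rintro _ ⟨y, hy, rfl⟩
    have h1 := real_inner_le_norm y θ
    have h2 := mem_closedBall_zero_iff.1 (hR hy)
    rw [hθ, mul_one] at h1
    exact h1.trans h2
  have h1 : inner ℝ (x + ε • θ) θ ≤ supportFun D θ := le_csSup hbdd ⟨_, hε, rfl⟩
  have h2 : supportFun D θ ≤ inner ℝ θ x := hx
  rw [inner_add_left, real_inner_smul_left, real_inner_self_eq_norm_sq, hθ,
    real_inner_comm] at h1
  have : (0 : ℝ) < ε := hε0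
  linarith

lemma isClosed_halfspace (D : Set (E d)) (θ : E d) : IsClosed (halfspace D θ) :=
  isClosed_le continuous_const (by fun_prop)

lemma convex_halfspace (D : Set (E d)) (θ : E d) : Convex ℝ (halfspace D θ) := by
  intro x hx y hy a b ha hb hab
  simp only [halfspace, Set.mem_ofPred_eq] at *
  rw [inner_add_right, real_inner_smul_right, real_inner_smul_right]
  calc supportFun D θ = a * supportFun D θ + b * supportFun D θ := by rw [← add_mul, hab, one_mul]
    _ ≤ _ := by gcongr

end Geometry

/-! ### The local kernels of the mean and of the covariance -/

section Weights

variable {d k : ℕ} {h : ℝ → (Fin (k + 1) → E d) → ℝ}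

lemma IsLocalKernel.eq_comp_smul (hh : IsLocalKernel k h) {r : ℝ} (hr : 0 < r)
    (x : Fin (k + 1) → E d) : h r x = h 1 (fun i => r⁻¹ • x i) := by
  rw [hh.scaling 1 zero_le_one r⁻¹ (inv_pos.2 hr) x, one_div, inv_inv]

lemma IsLocalKernel.exists_norm_sub_le (hh : IsLocalKernel k h) :
    ∃ κ : ℝ, ∀ x, h 1 x ≠ 0 → ∀ i j, ‖x i - x j‖ ≤ κ := by
  obtain ⟨κ, hκ⟩ := hh.locally_determined
  refine ⟨κ, fun x hx i j => ?_⟩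
  refine le_trans ?_ (hκ x (lt_of_le_of_ne (hh.nonneg 1 zero_le_one x) hx.symm))
  rw [← dist_eq_norm]
  exact Metric.dist_le_diam_of_mem (Set.finite_range x).isBounded ⟨i, rfl⟩ ⟨j, rfl⟩

lemma IsLocalKernel.isLocalWeight (hh : IsLocalKernel k h) : IsLocalWeight (h 1) where
  measurable := hh.measurable 1 zero_le_one
  nonneg := hh.nonneg 1 zero_le_one
  bounded := hh.bounded.imp fun _ hM => hM 1 zero_le_one
  translation := hh.translation 1 zero_le_one
  range := hh.exists_norm_sub_le.imp fun _ hκ x hx i => hκ x hx i 0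

/-- The product of two copies of a kernel that share `l` arguments. -/
def pairWeight {m l : ℕ} (hl : l ≤ k + 1) (hm : m + 1 + l = 2 * (k + 1))
    (kern : (Fin (k + 1) → E d) → ℝ) (z : Fin (m + 1) → E d) : ℝ :=
  kern (fun i => z (fstIdx hl hm i)) * kern (fun i => z (sndIdx hl hm i))

variable {m l : ℕ} (hl : l ≤ k + 1) (hm : m + 1 + l = 2 * (k + 1))

lemma fstIdx_zero : fstIdx hl hm 0 = 0 := rfl

lemma exists_fstIdx_or_sndIdx (j : Fin (m + 1)) :
    (∃ i, fstIdx hl hm i = j) ∨ ∃ i, sndIdx hl hm i = j := by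
  rcases lt_or_ge (j : ℕ) (k + 1) with h | h
  · exact Or.inl ((mem_range_fstIdx hl hm j).2 h)
  · exact Or.inr ((mem_range_sndIdx hl hm j).2 (Or.inr h))

lemma sndIdx_zero (hl0 : 0 < l) : sndIdx hl hm 0 = 0 := by
  simp [sndIdx, hl0]

/-- The two tuples share position `0` because `l > 0`, so all points lie within the range of the
kernel from that one. Without a shared point the range would be unbounded. -/
lemma IsLocalKernel.isLocalWeight_pair (hh : IsLocalKernel k h) (hl0 : 0 < l) :
    IsLocalWeight (pairWeight hl hm (h 1)) where
  measurable := by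
    have := hh.measurable 1 zero_le_one
    unfold pairWeight
    fun_prop
  nonneg x := mul_nonneg (hh.nonneg 1 zero_le_one _) (hh.nonneg 1 zero_le_one _)
  bounded := by
    obtain ⟨M, hM⟩ := hh.bounded
    refine ⟨M * M, fun x => ?_⟩
    have h0 := fun x => hh.nonneg 1 zero_le_one x
    have h1 := fun x => hM 1 zero_le_one x
    exact mul_le_mul (h1 _) (h1 _) (h0 _) ((h0 _).trans (h1 fun _ => 0))
  translation y x := by
    simp only [pairWeight]
    rw [hh.translation 1 zero_le_one y fun i => x (fstIdx hl hm i),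
      hh.translation 1 zero_le_one y fun i => x (sndIdx hl hm i)]
  range := by
    obtain ⟨κ, hκ⟩ := hh.exists_norm_sub_le
    refine ⟨κ, fun x hx j => ?_⟩
    obtain ⟨h1, h2⟩ := mul_ne_zero_iff.1 hx
    rcases exists_fstIdx_or_sndIdx hl hm j with ⟨i, rfl⟩ | ⟨i, rfl⟩
    · exact hκ _ h1 i 0
    · have := hκ _ h2 i 0
      rwa [sndIdx_zero hl hm hl0] at this

lemma withOrigin_eq_cons {d m : ℕ} (y : Fin m → E d) (j : Fin (m + 1)) :
    withOrigin y j = (Fin.cons 0 y : Fin (m + 1) → E d) j := by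
  refine Fin.cases ?_ (fun i => ?_) j
  · simp [withOrigin]
  · have : (1 : ℕ) ≤ i.succ ∧ (i.succ : ℕ) ≤ m := ⟨by simp, by simp⟩
    rw [withOrigin, dif_pos this]
    simp

lemma meanIntegrand_eq (kern : (Fin (k + 1) → E d) → ℝ) (G : E d → ℝ) (α : ℝ) (H : Set (E d))
    (q : E d × (Fin k → E d)) :
    meanIntegrand kern G α H q = kern (Fin.cons 0 q.2) * H.indicator (fun _ => (1 : ℝ)) q.1 *
      G q.1 ^ (-(α * ((k : ℝ) + 1))) := by
  classical
  have : (fun i : Fin (k + 1) => withOrigin q.2 i) = Fin.cons 0 q.2 :=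
    funext fun i => withOrigin_eq_cons q.2 i
  rw [meanIntegrand, this, Set.indicator_apply]

lemma covIntegrand_eq (kern : (Fin (k + 1) → E d) → ℝ) (G : E d → ℝ) (α : ℝ) (H : Set (E d))
    {l : ℕ} (hl : l ≤ k + 1) (hm : 2 * k + 1 - l + 1 + l = 2 * (k + 1))
    (q : E d × (Fin (2 * k + 1 - l) → E d)) :
    covIntegrand kern G α H l q = pairWeight hl hm kern (Fin.cons 0 q.2) *
      H.indicator (fun _ => (1 : ℝ)) q.1 *
      G q.1 ^ (-(α * (((2 * k + 1 - l : ℕ) : ℝ) + 1))) := by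
  classical
  have h1 : (fun i : Fin (k + 1) => withOrigin q.2 i)
      = fun i => (Fin.cons 0 q.2 : Fin _ → E d) (fstIdx hl hm i) :=
    funext fun i => withOrigin_eq_cons q.2 (fstIdx hl hm i)
  have h2 : (fun i : Fin (k + 1) =>
      withOrigin q.2 (if (i : ℕ) < l then (i : ℕ) else (i : ℕ) + (k + 1 - l)))
      = fun i => (Fin.cons 0 q.2 : Fin _ → E d) (sndIdx hl hm i) :=
    funext fun i => withOrigin_eq_cons q.2 (sndIdx hl hm i)
  have h3 : (2 * (k : ℝ) + 2 - (l : ℝ)) = ((2 * k + 1 - l : ℕ) : ℝ) + 1 := by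
    rw [Nat.cast_sub (by omega)]
    push_cast
    ring
  rw [covIntegrand, h1, h2, h3, Set.indicator_apply, pairWeight]

/-- The constraint sets for the points of a pair of tuples that share `l` points, where the first
tuple lies in `H₁` and the second one in `H₂`. -/
def pairSets (H₁ H₂ : Set (E d)) (j : Fin (m + 1)) : Set (E d) :=
  {x | (j ∈ Set.range (fstIdx hl hm) → x ∈ H₁) ∧ (j ∈ Set.range (sndIdx hl hm) → x ∈ H₂)}

lemma inter_subset_pairSets (H₁ H₂ : Set (E d)) (j : Fin (m + 1)) :
    H₁ ∩ H₂ ⊆ pairSets hl hm H₁ H₂ j := fun _ hx => ⟨fun _ => hx.1, fun _ => hx.2⟩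

lemma pairSets_zero (hl0 : 0 < l) (H₁ H₂ : Set (E d)) :
    pairSets hl hm H₁ H₂ 0 = H₁ ∩ H₂ := by
  refine subset_antisymm (fun x hx => ⟨hx.1 ⟨0, fstIdx_zero hl hm⟩, hx.2 ⟨0, sndIdx_zero hl hm hl0⟩⟩)
    (inter_subset_pairSets hl hm H₁ H₂ 0)

lemma measurableSet_pairSets {H₁ H₂ : Set (E d)} (h₁ : MeasurableSet H₁) (h₂ : MeasurableSet H₂)
    (j : Fin (m + 1)) : MeasurableSet (pairSets hl hm H₁ H₂ j) := by
  have aux : ∀ (p : Prop) {H : Set (E d)}, MeasurableSet H → MeasurableSet {x | p → x ∈ H} := by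
    intro p H hH
    by_cases hp : p
    · simpa [hp] using hH
    · simp [hp]
  exact (aux _ h₁).inter (aux _ h₂)

lemma pairSets_subset_union (H₁ H₂ : Set (E d)) (j : Fin (m + 1)) :
    pairSets hl hm H₁ H₂ j ⊆ H₁ ∪ H₂ := by
  intro x hx
  rcases exists_fstIdx_or_sndIdx hl hm j with h | h
  · exact Or.inl (hx.1 h)
  · exact Or.inr (hx.2 h)

/-- Points shared by both tuples must lie in `H₁ ∩ H₂`, the others only in one of the halfspaces. In
the limit all points merge with the shared base point, so only the intersection remains. -/
lemma prod_indicator_mul_prod_indicator (H₁ H₂ : Set (E d)) (z : Fin (m + 1) → E d) :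
    (∏ i, H₁.indicator (fun _ => (1 : ℝ)) (z (fstIdx hl hm i))) *
      (∏ i, H₂.indicator (fun _ => (1 : ℝ)) (z (sndIdx hl hm i)))
      = ∏ j, (pairSets hl hm H₁ H₂ j).indicator (fun _ => (1 : ℝ)) (z j) := by
  classical
  rw [prod_indicator_one (fun _ => H₁) fun i => z (fstIdx hl hm i),
    prod_indicator_one (fun _ => H₂) fun i => z (sndIdx hl hm i), prod_indicator_one]
  have hiff : z ∈ Set.univ.pi (pairSets hl hm H₁ H₂) ↔
      (fun i => z (fstIdx hl hm i)) ∈ Set.univ.pi (fun _ : Fin (k + 1) => H₁) ∧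
      (fun i => z (sndIdx hl hm i)) ∈ Set.univ.pi (fun _ : Fin (k + 1) => H₂) := by
    simp only [Set.mem_univ_pi, pairSets]
    constructor
    · exact fun h => ⟨fun i => (h _).1 ⟨i, rfl⟩, fun i => (h _).2 ⟨i, rfl⟩⟩
    · rintro ⟨h1, h2⟩ j
      exact ⟨fun ⟨i, hi⟩ => hi ▸ h1 i, fun ⟨i, hi⟩ => hi ▸ h2 i⟩
  simp only [Set.indicator_apply, hiff]
  split_ifs <;> simp_all

end Weights

/-! ### Moments of local `U`-statistics -/

section LocalMoments

variable {d k : ℕ} {h : ℝ → (Fin (k + 1) → E d) → ℝ}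

/-- The kernel `kern`, restricted to the tuples with entries in `A`. -/
noncomputable def restrictKernel (kern : (Fin (k + 1) → E d) → ℝ) (A : Set (E d))
    (x : Fin (k + 1) → E d) : ℝ :=
  kern x * ∏ i, A.indicator (fun _ => (1 : ℝ)) (x i)

lemma IsLocalKernel.measurable_restrict (hh : IsLocalKernel k h) {r : ℝ} (hr : 0 ≤ r)
    {A : Set (E d)} (hA : MeasurableSet A) : Measurable (restrictKernel (h r) A) :=
  (hh.measurable r hr).mul (Finset.measurable_fun_prod _ fun i _ =>
    measurable_indicator_one hA (measurable_pi_apply i))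

lemma IsLocalKernel.exists_abs_restrict_le (hh : IsLocalKernel k h) :
    ∃ M : ℝ, ∀ r, 0 ≤ r → ∀ (A : Set (E d)) x, |restrictKernel (h r) A x| ≤ M := by
  obtain ⟨M, hM⟩ := hh.bounded
  refine ⟨M, fun r hr A x => ?_⟩
  have h0 := hh.nonneg r hr x
  have h1 : ∀ i, 0 ≤ A.indicator (fun _ => (1 : ℝ)) (x i) := fun i =>
    Set.indicator_nonneg (fun _ _ => zero_le_one) _
  have h2 : ∀ i, A.indicator (fun _ => (1 : ℝ)) (x i) ≤ 1 := fun i =>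
    Set.indicator_le_self' (fun _ _ => zero_le_one) _
  rw [restrictKernel, abs_of_nonneg (mul_nonneg h0 (Finset.prod_nonneg fun i _ => h1 i))]
  exact (mul_le_of_le_one_right h0 (Finset.prod_le_one (fun i _ => h1 i) fun i _ => h2 i)).trans
    (hM r hr x)

lemma IsLocalKernel.restrict_symm (hh : IsLocalKernel k h) {r : ℝ} (hr : 0 ≤ r) (A : Set (E d))
    (σ : Equiv.Perm (Fin (k + 1))) (x : Fin (k + 1) → E d) :
    restrictKernel (h r) A (fun i => x (σ i)) = restrictKernel (h r) A x := by
  rw [restrictKernel, restrictKernel, hh.symm r hr σ x,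
    Equiv.prod_comp σ fun i => A.indicator (fun _ => (1 : ℝ)) (x i)]

lemma indicator_smul_set {t : ℝ} (ht : t ≠ 0) (A : Set (E d)) (x : E d) :
    (t • A).indicator (fun _ => (1 : ℝ)) x = A.indicator (fun _ => (1 : ℝ)) (t⁻¹ • x) := by
  classical
  simp only [Set.indicator_apply, Set.mem_smul_set_iff_inv_smul_mem₀ ht]

variable {G : E d → ℝ} {g : ℝ → ℝ}

lemma integral_pi_eq_pow_mul (hG : IsGaugeLike G) (hgpos : ∀ s, 0 ≤ s → 0 < g s)
    (hanti : AntitoneOn g (Set.Ici 0)) (hint : Integrable fun x => g (G x)) (n : ℕ) {m : ℕ}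
    (u : (Fin (m + 1) → E d) → ℝ) :
    ∫ z, u z ∂(Measure.pi fun _ : Fin (m + 1) =>
        volume.withDensity fun x => ENNReal.ofReal ((n : ℝ) * g (G x)))
      = (n : ℝ) ^ (m + 1) * ∫ z, u z * ∏ i, g (G (z i)) := by
  rw [integral_pi_withDensity_ofReal (hint.const_mul _) ((hG.measurable_comp hanti).const_mul _)
    (fun x => mul_nonneg n.cast_nonneg (hgpos _ (hG.nonneg x)).le), ← integral_const_mul]
  refine integral_congr_ae (ae_of_all _ fun z => ?_)
  simp only [Finset.prod_mul_distrib, Finset.prod_const, Finset.card_univ, Fintype.card_fin]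
  ring

lemma IsLocalKernel.integral_restrict (hh : IsLocalKernel k h) (hG : IsGaugeLike G)
    (hgpos : ∀ s, 0 ≤ s → 0 < g s) (hanti : AntitoneOn g (Set.Ici 0))
    (hint : Integrable fun x => g (G x)) (n : ℕ) {t r : ℝ} (ht : 0 < t) (hr : 0 < r)
    (H : Set (E d)) :
    ∫ z, restrictKernel (h r) (t • H) z ∂(Measure.pi fun _ : Fin (k + 1) =>
        volume.withDensity fun x => ENNReal.ofReal ((n : ℝ) * g (G x)))
      = (n : ℝ) ^ (k + 1) * localIntegral (h 1) (fun _ => H) G g t r := by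
  rw [integral_pi_eq_pow_mul hG hgpos hanti hint, localIntegral]
  congr 1
  refine integral_congr_ae (ae_of_all _ fun z => ?_)
  simp only [restrictKernel, hh.eq_comp_smul hr z, indicator_smul_set ht.ne',
    Finset.prod_mul_distrib]
  ring

lemma IsLocalKernel.integral_pair_restrict (hh : IsLocalKernel k h) (hG : IsGaugeLike G)
    (hgpos : ∀ s, 0 ≤ s → 0 < g s) (hanti : AntitoneOn g (Set.Ici 0))
    (hint : Integrable fun x => g (G x)) (n : ℕ) {t r : ℝ} (ht : 0 < t) (hr : 0 < r)
    (H₁ H₂ : Set (E d)) {M m l : ℕ} (hl : l ≤ k + 1) (hM : M + l = 2 * (k + 1))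
    (hm : m + 1 + l = 2 * (k + 1)) :
    ∫ z, restrictKernel (h r) (t • H₁) (fun i => z (fstIdx hl hM i)) *
        restrictKernel (h r) (t • H₂) (fun i => z (sndIdx hl hM i))
        ∂(Measure.pi fun _ : Fin M =>
          volume.withDensity fun x => ENNReal.ofReal ((n : ℝ) * g (G x)))
      = (n : ℝ) ^ (m + 1) *
        localIntegral (pairWeight hl hm (h 1)) (pairSets hl hm H₁ H₂) G g t r := by
  -- The covariance formula counts the points as `2 * N - l`, which is not syntactically a
  -- successor; `M` and `m + 1` are identified here.
  obtain rfl : M = m + 1 := by omega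
  rw [integral_pi_eq_pow_mul hG hgpos hanti hint, localIntegral]
  congr 1
  refine integral_congr_ae (ae_of_all _ fun z => ?_)
  simp only [restrictKernel, hh.eq_comp_smul hr, indicator_smul_set ht.ne',
    Finset.prod_mul_distrib, pairWeight]
  rw [← prod_indicator_mul_prod_indicator hl hm H₁ H₂ fun i => t⁻¹ • z i]
  ring

end LocalMoments

/-! ### Change of variables under an initial transformation -/

section Transformation

variable {d k : ℕ} {D : Set (E d)} {θ : E d} {A : E d ≃ₗ[ℝ] E d}

lemma gauge_preimage_linearEquiv (A : E d ≃ₗ[ℝ] E d) (D : Set (E d)) (x : E d) :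
    gauge (A ⁻¹' D) x = gauge D (A x) := by
  simp only [gauge]
  congr 1
  ext r
  refine and_congr_right fun hr => ?_
  have hr' : r ≠ 0 := ne_of_gt hr
  rw [Set.mem_smul_set_iff_inv_smul_mem₀ hr', Set.mem_smul_set_iff_inv_smul_mem₀ hr',
    Set.mem_preimage, map_smul]

lemma IsInitialTransformation.mem_iff (hA : IsInitialTransformation D θ A) (x : E d) :
    1 ≤ inner ℝ (vert d) x ↔ A x ∈ halfspace D θ := by
  rw [← hA.map_halfspace]
  exact (A.injective.mem_set_image (s := {x : E d | 1 ≤ inner ℝ (vert d) x})).symm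

lemma IsInitialTransformation.meanIntegrand_comp (hA : IsInitialTransformation D θ A)
    (kern : (Fin (k + 1) → E d) → ℝ) (α : ℝ) :
    meanIntegrand kern (gauge (A ⁻¹' D)) α {x : E d | 1 ≤ inner ℝ (vert d) x}
      = meanIntegrand kern (gauge D) α (halfspace D θ) ∘ Prod.map A id := by
  classical
  funext q
  simp only [Function.comp_apply, meanIntegrand, Prod.map_fst, Prod.map_snd, id_eq,
    gauge_preimage_linearEquiv, Set.mem_ofPred_eq, hA.mem_iff]

lemma measurePreserving_linearEquiv_prod (A : E d ≃ₗ[ℝ] E d) (k : ℕ) :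
    MeasurePreserving (Prod.map A id : E d × (Fin k → E d) → E d × (Fin k → E d)) volume
      (ENNReal.ofReal |(LinearMap.det (A : E d →ₗ[ℝ] E d))⁻¹| • volume) := by
  have h1 : MeasurePreserving A volume
      (ENNReal.ofReal |(LinearMap.det (A : E d →ₗ[ℝ] E d))⁻¹| • volume) :=
    ⟨A.toContinuousLinearEquiv.continuous.measurable,
      Measure.map_linearMap_addHaar_eq_smul_addHaar volume A.isUnit_det'.ne_zero⟩
  have h2 := h1.prod (MeasurePreserving.id (volume : Measure (Fin k → E d)))
  rw [Measure.prod_smul_left] at h2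
  exact h2

lemma measurableEmbedding_linearEquiv_prod (A : E d ≃ₗ[ℝ] E d) (k : ℕ) :
    MeasurableEmbedding (Prod.map A id : E d × (Fin k → E d) → E d × (Fin k → E d)) :=
  (A.toContinuousLinearEquiv.toHomeomorph.prodCongr
    (Homeomorph.refl (Fin k → E d))).measurableEmbedding

lemma IsInitialTransformation.integrable_meanIntegrand (hA : IsInitialTransformation D θ A)
    {kern : (Fin (k + 1) → E d) → ℝ} {α : ℝ}
    (hint : Integrable (meanIntegrand kern (gauge D) α (halfspace D θ))) :
    Integrable
      (meanIntegrand kern (gauge (A ⁻¹' D)) α {x : E d | 1 ≤ inner ℝ (vert d) x}) := by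
  rw [hA.meanIntegrand_comp, (measurePreserving_linearEquiv_prod A k).integrable_comp_emb
    (measurableEmbedding_linearEquiv_prod A k)]
  exact hint.smul_measure ENNReal.ofReal_ne_top

/-- The map `A` acts on `x` only; `A⁻¹` takes the halfspace to `{v ≥ 1}`, and the gauge of `A ⁻¹' D`
is the gauge of `D` composed with `A`. -/
lemma IsInitialTransformation.abs_det_mul_integral (hA : IsInitialTransformation D θ A)
    (kern : (Fin (k + 1) → E d) → ℝ) (α : ℝ) :
    |LinearMap.det (A : E d →ₗ[ℝ] E d)| *
        ∫ q, meanIntegrand kern (gauge (A ⁻¹' D)) α {x : E d | 1 ≤ inner ℝ (vert d) x} q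
      = ∫ q, meanIntegrand kern (gauge D) α (halfspace D θ) q := by
  have h1 := (measurePreserving_linearEquiv_prod A k).integral_comp
    (measurableEmbedding_linearEquiv_prod A k) (meanIntegrand kern (gauge D) α (halfspace D θ))
  rw [integral_smul_measure, ENNReal.toReal_ofReal (abs_nonneg _), smul_eq_mul] at h1
  have hdet : |LinearMap.det (A : E d →ₗ[ℝ] E d)| ≠ 0 := abs_ne_zero.2 A.isUnit_det'.ne_zero
  rw [hA.meanIntegrand_comp]
  refine (congrArg _ h1).trans ?_
  rw [abs_inv, mul_inv_cancel_left₀ hdet]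

end Transformation

/-! ### The three regimes -/

lemma sum_Icc_eq_sum_fin {M : Type*} [AddCommMonoid M] (k : ℕ) (F : ℕ → M) :
    ∑ l ∈ Finset.Icc 1 (k + 1), F l = ∑ l : Fin (k + 1), F (l + 1) := by
  rw [Fin.sum_univ_eq_sum_range fun l => F (l + 1), Finset.range_eq_Ico,
    Finset.sum_Ico_add' F 0 (k + 1) 1]
  rfl

section Regimes

variable {k d : ℕ} {V a b t r : ℕ → ℝ} {c I : Fin (k + 1) → ℝ} {Q : Fin (k + 1) → ℕ → ℝ}

/-- The index `l` is the number of common points minus one. After division by `a ^ k` the term `l`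
carries `a ^ (k - l)`, so only full overlap, `l = k`, survives as `a → 0`. -/
lemma tendsto_sparse (hV : ∀ᶠ n in atTop, V n = b n * ∑ l, c l * a n ^ (2 * k - (l : ℕ)) * Q l n)
    (hb : ∀ᶠ n in atTop, 0 < b n) (ha : ∀ᶠ n in atTop, 0 < a n)
    (hQ : ∀ l, Tendsto (Q l) atTop (𝓝 (I l))) (h0 : Tendsto a atTop (𝓝 0)) :
    Tendsto (fun n => V n / (b n * a n ^ k)) atTop (𝓝 (c (Fin.last k) * I (Fin.last k))) := by
  have hlim : Tendsto (fun n => ∑ l, c l * a n ^ (k - (l : ℕ)) * Q l n) atTop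
      (𝓝 (∑ l, c l * (if l = Fin.last k then 1 else 0) * I l)) := by
    refine tendsto_finsetSum _ fun l _ => (Tendsto.const_mul _ ?_).mul (hQ l)
    split_ifs with hl
    · subst hl
      simp
    · have : k - (l : ℕ) ≠ 0 := by
        have h1 : (l : ℕ) ≠ k := fun h => hl (Fin.ext h)
        omega
      simpa [this] using h0.pow (k - (l : ℕ))
  have hsum : ∑ l, c l * (if l = Fin.last k then 1 else 0) * I l
      = c (Fin.last k) * I (Fin.last k) := by simp
  rw [hsum] at hlim
  refine hlim.congr' ?_
  filter_upwards [hV, hb, ha] with n h1 h2 h3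
  rw [h1, mul_div_mul_left _ _ h2.ne', eq_div_iff (by positivity), Finset.sum_mul]
  refine Finset.sum_congr rfl fun l _ => ?_
  rw [show 2 * k - (l : ℕ) = k - l + k by omega, pow_add]
  ring

lemma tendsto_thermodynamic
    (hV : ∀ᶠ n in atTop, V n = b n * ∑ l, c l * a n ^ (2 * k - (l : ℕ)) * Q l n)
    (hb : ∀ᶠ n in atTop, 0 < b n) (hQ : ∀ l, Tendsto (Q l) atTop (𝓝 (I l))) {χ : ℝ}
    (h0 : Tendsto a atTop (𝓝 χ)) :
    Tendsto (fun n => V n / b n) atTop (𝓝 (∑ l, c l * χ ^ (2 * k - (l : ℕ)) * I l)) := by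
  have hlim : Tendsto (fun n => ∑ l, c l * a n ^ (2 * k - (l : ℕ)) * Q l n) atTop
      (𝓝 (∑ l, c l * χ ^ (2 * k - (l : ℕ)) * I l)) :=
    tendsto_finsetSum _ fun l _ => ((h0.pow _).const_mul _).mul (hQ l)
  refine hlim.congr' ?_
  filter_upwards [hV, hb] with n h1 h2
  rw [h1, mul_div_cancel_left₀ _ h2.ne']

/-- After division by `a ^ (2 * k)` the term `l` carries `a⁻¹ ^ l`, so only pairs with a single
common point survive as `a → ∞`. -/
lemma tendsto_dense (hV : ∀ᶠ n in atTop, V n = b n * ∑ l, c l * a n ^ (2 * k - (l : ℕ)) * Q l n)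
    (hb : ∀ᶠ n in atTop, 0 < b n) (hQ : ∀ l, Tendsto (Q l) atTop (𝓝 (I l)))
    (h0 : Tendsto a atTop atTop) :
    Tendsto (fun n => V n / (b n * a n ^ (2 * k))) atTop (𝓝 (c 0 * I 0)) := by
  have hlim : Tendsto (fun n => ∑ l, c l * (a n)⁻¹ ^ (l : ℕ) * Q l n) atTop
      (𝓝 (∑ l, c l * (if l = 0 then 1 else 0) * I l)) := by
    refine tendsto_finsetSum _ fun l _ => (Tendsto.const_mul _ ?_).mul (hQ l)
    split_ifs with hl
    · subst hl
      simp
    · have : (l : ℕ) ≠ 0 := fun h => hl (Fin.ext h)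
      simpa [this] using h0.inv_tendsto_atTop.pow (l : ℕ)
  have hsum : ∑ l, c l * (if l = 0 then 1 else 0) * I l = c 0 * I 0 := by simp
  rw [hsum] at hlim
  refine hlim.congr' ?_
  filter_upwards [hV, hb, h0.eventually_gt_atTop 0] with n h1 h2 h3
  rw [h1, mul_div_mul_left _ _ h2.ne', eq_div_iff (by positivity), Finset.sum_mul]
  refine Finset.sum_congr rfl fun l _ => ?_
  have h4 : a n ^ (2 * k) = a n ^ (2 * k - (l : ℕ)) * a n ^ (l : ℕ) := by
    rw [← pow_add]
    congr 1
    omega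
  rw [h4, inv_pow]
  field_simp

end Regimes

end HalfspaceUStat

/-! ### Assembly of the moment formulas and the limits -/

theorem propositionp
    (d k : ℕ) (D : Set (E d)) (hDopen : IsOpen D) (hDconv : Convex ℝ D)
    (hDbdd : Bornology.IsBounded D) (hD0 : (0 : E d) ∈ D)
    -- the density generator and the density `f = g ∘ γ_D`
    (g : ℝ → ℝ) (α : ℝ) (hα : (d : ℝ) < α)
    (hgpos : ∀ s, 0 ≤ s → 0 < g s) (hganti : AntitoneOn g (Set.Ici 0))
    (hgRV : RegularlyVarying g (-α))
    (hfdens : ∫ x : E d, g (gauge D x) = 1)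
    -- the kernels
    (h : ℝ → (Fin (k + 1) → E d) → ℝ) (hh : IsLocalKernel k h)
    -- the sequences `t_n → ∞` and `r_n → r₀ ∈ [0, ∞)`
    (t r : ℕ → ℝ) (ht : Tendsto t atTop atTop)
    (hrpos : ∀ n, 0 < r n) (r₀ : ℝ) (hr : Tendsto r atTop (𝓝 r₀))
    -- the Poisson processes with intensities `n f`
    {Ω : Type*} [MeasurableSpace Ω] (P : Measure Ω) [IsProbabilityMeasure P]
    (X : ℕ → Ω → Set (E d))
    (hX : ∀ n : ℕ, IsPoissonProcess (X n)
      (volume.withDensity fun x => ENNReal.ofReal ((n : ℝ) * g (gauge D x))) P)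
    -- the statistics `S_{k,n}(θ)`
    (S : ℕ → E d → Ω → ℝ)
    (hS : ∀ n θ ω, S n θ ω = uStat (h (r n)) (X n ω ∩ t n • halfspace D θ)) :
    -- the moments exist
    (∀ n (θ : E d), ‖θ‖ = 1 → MemLp (S n θ) 2 P) ∧
    -- the expectation, through the halfspace `H(θ)` itself
    (∀ θ : E d, ‖θ‖ = 1 →
      Integrable (meanIntegrand (h 1) (gauge D) α (halfspace D θ)) ∧
      Tendsto
        (fun n : ℕ => (∫ ω, S n θ ω ∂P)
          / (((n : ℝ) * g (t n)) ^ (k + 1) * r n ^ (d * k) * t n ^ d)) atTop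
        (𝓝 (1 / ((k + 1)! : ℝ) *
          ∫ q, meanIntegrand (h 1) (gauge D) α (halfspace D θ) q))) ∧
    -- the expectation, through any initial transformation `A`
    (∀ θ : E d, ‖θ‖ = 1 → ∀ A : E d ≃ₗ[ℝ] E d, IsInitialTransformation D θ A →
      Integrable
        (meanIntegrand (h 1) (gauge (A ⁻¹' D)) α {x : E d | 1 ≤ inner ℝ (vert d) x}) ∧
      Tendsto
        (fun n : ℕ => (∫ ω, S n θ ω ∂P)
          / (((n : ℝ) * g (t n)) ^ (k + 1) * r n ^ (d * k) * t n ^ d)) atTop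
        (𝓝 (|LinearMap.det (A : E d →ₗ[ℝ] E d)| / ((k + 1)! : ℝ) *
          ∫ q, meanIntegrand (h 1) (gauge (A ⁻¹' D)) α
            {x : E d | 1 ≤ inner ℝ (vert d) x} q))) ∧
    -- the covariance, in the three regimes
    (∀ θ₁ θ₂ : E d, ‖θ₁‖ = 1 → ‖θ₂‖ = 1 →
      (∀ l ∈ Finset.Icc 1 (k + 1), Integrable
        (covIntegrand (h 1) (gauge D) α (halfspace D θ₁ ∩ halfspace D θ₂) l)) ∧
      (Tendsto (fun n : ℕ => (n : ℝ) * g (t n) * r n ^ d) atTop (𝓝 0) →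
        Tendsto
          (fun n : ℕ => covariance (S n θ₁) (S n θ₂) P
            / (((n : ℝ) * g (t n)) ^ (k + 1) * r n ^ (d * k) * t n ^ d)) atTop
          (𝓝 (covIntegral (h 1) (gauge D) α (halfspace D θ₁ ∩ halfspace D θ₂) (k + 1)
            / ((k + 1)! : ℝ)))) ∧
      (∀ χ : ℝ, 0 < χ →
        Tendsto (fun n : ℕ => (n : ℝ) * g (t n) * r n ^ d) atTop (𝓝 χ) →
        Tendsto
          (fun n : ℕ => covariance (S n θ₁) (S n θ₂) P
            / ((n : ℝ) * g (t n) * t n ^ d)) atTop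
          (𝓝 (∑ l ∈ Finset.Icc 1 (k + 1),
            χ ^ (2 * k + 1 - l)
              * covIntegral (h 1) (gauge D) α (halfspace D θ₁ ∩ halfspace D θ₂) l
              / ((l ! : ℝ) * ((k + 1 - l)! : ℝ) ^ 2)))) ∧
      (Tendsto (fun n : ℕ => (n : ℝ) * g (t n) * r n ^ d) atTop atTop →
        Tendsto
          (fun n : ℕ => covariance (S n θ₁) (S n θ₂) P
            / (((n : ℝ) * g (t n)) ^ (2 * k + 1) * r n ^ (2 * d * k) * t n ^ d)) atTop
          (𝓝 (covIntegral (h 1) (gauge D) α (halfspace D θ₁ ∩ halfspace D θ₂) 1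
            / ((k ! : ℝ) ^ 2))))) := by
  have hG := isGaugeLike_gauge hDopen hDconv hDbdd hD0
  -- A Bochner integral of a non-integrable function is zero, so the value one forces integrability.
  have hint : Integrable fun x : E d => g (gauge D x) :=
    Integrable.of_integral_ne_zero (by rw [hfdens]; exact one_ne_zero)
  have hH1 : ∀ {θ : E d}, ‖θ‖ = 1 → ∀ x ∈ halfspace D θ, 1 ≤ gauge D x := fun hθ x hx =>
    one_le_gauge_of_mem_halfspace hDopen hDconv hDbdd hD0 hθ hx
  have hHm : ∀ θ : E d, MeasurableSet (halfspace D θ) := fun θ =>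
    (isClosed_halfspace D θ).measurableSet
  have hfin : ∀ n : ℕ, IsFiniteMeasure
      ((volume : Measure (E d)).withDensity fun x => ENNReal.ofReal ((n : ℝ) * g (gauge D x))) :=
    fun n => isFiniteMeasure_withDensity_ofReal (hint.const_mul _).2
  have hAm : ∀ n (θ : E d), MeasurableSet (t n • halfspace D θ) := fun n θ =>
    (hHm θ).const_smul₀ _
  obtain ⟨M, hM⟩ := hh.exists_abs_restrict_le
  let T : ℕ → E d → Ω → ℝ := fun n θ ω => ∫ x, restrictKernel (h (r n)) (t n • halfspace D θ) x
    ∂(tupleMeasure (Fin (k + 1)) (X n ω))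
  -- The equality is only almost sure: if the point set is infinite, `tupleMeasure` is zero while
  -- the series in `uStat` need not be.
  have hST : ∀ n θ, S n θ =ᵐ[P] fun ω => (1 / ((k + 1)! : ℝ)) * T n θ ω := by
    intro n θ
    filter_upwards [(hX n).ae_finite] with ω hω
    rw [hS, uStat_inter_eq (hh.measurable _ (hrpos n).le) hω (hAm n θ)]
    rfl
  have hTmem : ∀ n θ, MemLp (T n θ) 2 P := fun n θ =>
    (hX n).memLp_tuple_sum (hh.measurable_restrict (hrpos n).le (hAm n θ))
      (hM _ (hrpos n).le _) (hh.restrict_symm (hrpos n).le _)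
  have htpos := ht.eventually_gt_atTop 0
  have hnpos := eventually_gt_atTop (0 : ℕ)
  have hmean : ∀ θ : E d, ‖θ‖ = 1 →
      Integrable (meanIntegrand (h 1) (gauge D) α (halfspace D θ)) ∧
      Tendsto
        (fun n : ℕ => (∫ ω, S n θ ω ∂P)
          / (((n : ℝ) * g (t n)) ^ (k + 1) * r n ^ (d * k) * t n ^ d)) atTop
        (𝓝 (1 / ((k + 1)! : ℝ) *
          ∫ q, meanIntegrand (h 1) (gauge D) α (halfspace D θ) q)) := by
    intro θ hθ
    have hEq : meanIntegrand (h 1) (gauge D) α (halfspace D θ) = _ :=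
      funext fun q => meanIntegrand_eq (h 1) (gauge D) α (halfspace D θ) q
    rw [hEq]
    refine ⟨integrable_limit hG hh.isLocalWeight (hHm θ) (hH1 hθ) hα, ?_⟩
    have hlim := tendsto_localIntegral (K := fun _ => halfspace D θ) hG hh.isLocalWeight hα hgpos
      hganti hgRV (fun _ => hHm θ) (fun _ => hH1 hθ) (convex_halfspace D θ)
      (fun _ => subset_rfl) ht hrpos hr
    refine (hlim.const_mul (1 / ((k + 1)! : ℝ))).congr' ?_
    filter_upwards [htpos, hnpos] with n hn hn0
    have hn1 : (0 : ℝ) < n := Nat.cast_pos.2 hn0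
    have hg := hgpos _ hn.le
    have hrn := hrpos n
    rw [integral_congr_ae (hST n θ), integral_const_mul,
      (hX n).integral_tuple_sum (integrable_pi_of_bounded
        (hh.measurable_restrict (hrpos n).le (hAm n θ)) (hM _ (hrpos n).le _)),
      hh.integral_restrict hG hgpos hganti hint n hn hrn, mul_pow]
    field_simp
  refine ⟨fun n θ _ => ((hTmem n θ).const_mul _).ae_eq (hST n θ).symm, hmean, ?_, ?_⟩
  · intro θ hθ A hA
    obtain ⟨h1, h2⟩ := hmean θ hθ
    refine ⟨hA.integrable_meanIntegrand h1, ?_⟩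
    rw [div_mul_eq_mul_div, hA.abs_det_mul_integral]
    rwa [one_div_mul_eq_div] at h2
  · intro θ₁ θ₂ hθ₁ hθ₂
    have hHH : MeasurableSet (halfspace D θ₁ ∩ halfspace D θ₂) := (hHm θ₁).inter (hHm θ₂)
    -- From here `l : Fin (k + 1)` stands for `l + 1` common points, so a pair of tuples has `2 * k
    -- + 1 - (l + 1)` points besides the base point.
    have hidx : ∀ l : Fin (k + 1),
        2 * k + 1 - ((l : ℕ) + 1) + 1 + ((l : ℕ) + 1) = 2 * (k + 1) := fun l => by omega
    have hidl : ∀ l : Fin (k + 1), (l : ℕ) + 1 ≤ k + 1 := fun l => by omega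
    let Q : Fin (k + 1) → ℕ → ℝ := fun l n =>
      localIntegral (pairWeight (hidl l) (hidx l) (h 1))
        (pairSets (hidl l) (hidx l) (halfspace D θ₁) (halfspace D θ₂)) (gauge D) g (t n) (r n) /
        (g (t n) ^ (2 * k + 1 - ((l : ℕ) + 1) + 1) *
          (t n ^ d * r n ^ (d * (2 * k + 1 - ((l : ℕ) + 1)))))
    let I : Fin (k + 1) → ℝ := fun l =>
      covIntegral (h 1) (gauge D) α (halfspace D θ₁ ∩ halfspace D θ₂) (l + 1)
    let c : Fin (k + 1) → ℝ := fun l =>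
      1 / (((l + 1 : ℕ)! : ℝ) * ((k + 1 - (l + 1))! : ℝ) ^ 2)
    have hQ : ∀ l, Tendsto (Q l) atTop (𝓝 (I l)) := by
      intro l
      have h0 := pairSets_zero (hidl l) (hidx l) (Nat.succ_pos _) (halfspace D θ₁) (halfspace D θ₂)
      have hlim := tendsto_localIntegral hG
        (hh.isLocalWeight_pair (hidl l) (hidx l) (Nat.succ_pos _)) hα hgpos hganti hgRV
        (K := pairSets (hidl l) (hidx l) (halfspace D θ₁) (halfspace D θ₂))
        (measurableSet_pairSets _ _ (hHm θ₁) (hHm θ₂))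
        (fun i x hx => (pairSets_subset_union _ _ _ _ i hx).elim (hH1 hθ₁ x) (hH1 hθ₂ x))
        (by rw [h0]; exact (convex_halfspace D θ₁).inter (convex_halfspace D θ₂))
        (fun i => by rw [h0]; exact inter_subset_pairSets _ _ _ _ i) ht hrpos hr
      have hI : I l = _ := integral_congr_ae (ae_of_all _ fun q =>
        covIntegrand_eq (h 1) (gauge D) α (halfspace D θ₁ ∩ halfspace D θ₂) (hidl l) (hidx l) q)
      rw [hI]
      rw [h0] at hlim
      exact hlim
    -- The prefactors `1 / (k + 1)!` of the two statistics cancel the `(N !) ^ 2` of the overlap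
    -- count, which leaves the coefficients `c l`.
    have hV : ∀ᶠ n : ℕ in atTop, covariance (S n θ₁) (S n θ₂) P
        = ((n : ℝ) * g (t n) * t n ^ d) *
          ∑ l, c l * ((n : ℝ) * g (t n) * r n ^ d) ^ (2 * k - (l : ℕ)) * Q l n := by
      filter_upwards [htpos, hnpos] with n hn hn0
      have hn1 : (0 : ℝ) < n := Nat.cast_pos.2 hn0
      have hg := hgpos _ hn.le
      have hrn := hrpos n
      have hcov : covariance (S n θ₁) (S n θ₂) P
          = covariance (fun ω => (1 / ((k + 1)! : ℝ)) * T n θ₁ ω)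
            (fun ω => (1 / ((k + 1)! : ℝ)) * T n θ₂ ω) P := by
        simp only [covariance]
        rw [integral_congr_ae (hST n θ₁), integral_congr_ae (hST n θ₂)]
        refine integral_congr_ae ?_
        filter_upwards [hST n θ₁, hST n θ₂] with ω h1 h2
        rw [h1, h2]
      rw [hcov, covariance_const_mul_left, covariance_const_mul_right,
        (hX n).covariance_tuple_sum (hh.measurable_restrict hrn.le (hAm n θ₁))
          (hh.measurable_restrict hrn.le (hAm n θ₂)) (hM _ hrn.le _) (hM _ hrn.le _)
          (hh.restrict_symm hrn.le _) (hh.restrict_symm hrn.le _),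
        Finset.mul_sum, Finset.mul_sum, Finset.mul_sum]
      refine Finset.sum_congr rfl fun l _ => ?_
      rw [hh.integral_pair_restrict hG hgpos hganti hint n hn hrn _ _ (hidl l) _ (hidx l)]
      simp only [Q, c]
      have hml : 2 * k + 1 - ((l : ℕ) + 1) = 2 * k - (l : ℕ) := by omega
      generalize localIntegral (pairWeight (hidl l) (hidx l) (h 1))
        (pairSets (hidl l) (hidx l) (halfspace D θ₁) (halfspace D θ₂)) (gauge D) g (t n) (r n) = J
      rw [hml]
      have hf1 : ((k + 1)! : ℝ) ≠ 0 := Nat.cast_ne_zero.2 (Nat.factorial_ne_zero _)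
      have hf2 : (((l + 1 : ℕ))! : ℝ) ≠ 0 := Nat.cast_ne_zero.2 (Nat.factorial_ne_zero _)
      have hf3 : ((k + 1 - (l + 1))! : ℝ) ≠ 0 := Nat.cast_ne_zero.2 (Nat.factorial_ne_zero _)
      rw [mul_pow, mul_pow, ← pow_mul]
      field_simp
      ring
    have hb : ∀ᶠ n : ℕ in atTop, 0 < (n : ℝ) * g (t n) * t n ^ d := by
      filter_upwards [htpos, hnpos] with n hn hn0
      have hn1 : (0 : ℝ) < n := Nat.cast_pos.2 hn0
      have hg := hgpos _ hn.le
      positivity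
    have ha : ∀ᶠ n : ℕ in atTop, 0 < (n : ℝ) * g (t n) * r n ^ d := by
      filter_upwards [htpos, hnpos] with n hn hn0
      have hn1 : (0 : ℝ) < n := Nat.cast_pos.2 hn0
      have hg := hgpos _ hn.le
      have hrn := hrpos n
      positivity
    refine ⟨?_, ?_, ?_, ?_⟩
    · intro l hl
      obtain ⟨hl1, hl2⟩ := Finset.mem_Icc.1 hl
      have hm : 2 * k + 1 - l + 1 + l = 2 * (k + 1) := by omega
      have hEq : covIntegrand (h 1) (gauge D) α (halfspace D θ₁ ∩ halfspace D θ₂) l = _ :=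
        funext fun q => covIntegrand_eq (h 1) (gauge D) α _ hl2 hm q
      rw [hEq]
      exact integrable_limit hG (hh.isLocalWeight_pair hl2 hm hl1) hHH
        (fun x hx => hH1 hθ₁ x hx.1) hα
    · intro h0
      have hlim := tendsto_sparse hV hb ha hQ h0
      have hval : c (Fin.last k) * I (Fin.last k)
          = covIntegral (h 1) (gauge D) α (halfspace D θ₁ ∩ halfspace D θ₂) (k + 1)
            / ((k + 1)! : ℝ) := by
        simp only [c, I, Fin.val_last, Nat.sub_self, Nat.factorial_zero]
        push_cast
        ring
      rw [hval] at hlim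
      refine hlim.congr fun n => ?_
      congr 1
      rw [pow_mul (r n)]
      ring
    · intro χ _ hχ
      have hlim := tendsto_thermodynamic hV hb hQ hχ
      rw [sum_Icc_eq_sum_fin]
      convert! hlim using 2
      refine Finset.sum_congr rfl fun l _ => ?_
      simp only [c, I]
      rw [show 2 * k + 1 - ((l : ℕ) + 1) = 2 * k - (l : ℕ) by omega]
      ring
    · intro h0
      have hlim := tendsto_dense hV hb hQ h0
      have hval : c 0 * I 0
          = covIntegral (h 1) (gauge D) α (halfspace D θ₁ ∩ halfspace D θ₂) 1
            / ((k ! : ℝ) ^ 2) := by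
        simp [c, I]
        ring
      rw [hval] at hlim
      refine hlim.congr fun n => ?_
      congr 1
      rw [show 2 * d * k = d * (2 * k) by ring, pow_mul (r n)]
      ring
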